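/- Let $k\ge 1$ be a fixed integer. For a finite tree $T$ with vertex set $V(T)$ and graph distance $d$, put $d_k(u,v)=\min(d(u,v),k+1)$. A vertex $v$ is $k$-dominated by $S\subseteq V(T)$ if $d(v,x)\le k$ for some $x\in S$. A set $S\subseteq V(T)$ is a $k$-truncated resolving set if for all distinct $u,v\in V(T)$ there is $x\in S$ with $d_k(u,x)\ne d_k(v,x)$; it is a $k$-truncated dominating resolving set if moreover every vertex is $k$-dominated by $S$. Let $\dim_k(T)$ be the least size of a $k$-truncated resolving set of $T$, let $s_{\mathrm{mdr}}(T)$ be the least size of a $k$-truncated dominating resolving set of $T$, and let $s_{\min}(T)$ be the minimum, over all $r\in V(T)$, of the size of a $k$-truncated resolving set $S$ of $T$ such that $r$ is the only vertex of $T$ that is not $k$-dominated by $S$ ($s_{\min}(T)=\infty$ if no such $r$ and $S$ exist). Then: 1. $\dim_k(T)=\min\bigl(s_{\mathrm{mdr}}(T),\,s_{\min}(T)\bigr)$ for every finite tree $T$. 2. There is an algorithm that, given a tree $T$ with $n$ vertices, computes $s_{\mathrm{mdr}}(T)$ in $O(n)$ time. 3. There is an algorithm that, given a tree $T$ with $n$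 vertices, computes $\dim_k(T)$ in $O(n^2)$ time; in particular $\dim_k(T)$ is computable in polynomial time. Here the tree has the vertices $0,\dots,n-1$ and is given by a list of its edges in arbitrary order. An algorithm is a program for a random access machine with words of $O(\log n)$ bits (all numbers that occur are bounded by a polynomial in $n$), in which each constant or register operand, array access, addition, truncated subtraction, assignment and zero test costs one step. The programs and the implied constants depend only on $k$. -/

import Mathlib

/-! ### Truncated resolving sets -/

namespace SimpleGraph

variable {V : Type*}

/-- The `k`-truncated distance `d_k(u, v) = min (d(u, v)) (k + 1)`. It is used for connected
graphs only, so the value `0` of `dist` on vertices in different components plays no role. -/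
noncomputable def truncDist (G : SimpleGraph V) (k : ℕ) (u v : V) : ℕ :=
  min (G.dist u v) (k + 1)

/-- `w` `k`-distinguishes `u` and `v`. -/
def Distinguishes (G : SimpleGraph V) (k : ℕ) (w u v : V) : Prop :=
  G.truncDist k u w ≠ G.truncDist k v w

/-- `v` is `k`-dominated by `S`: it is at distance at most `k` from some vertex of `S`. -/
def IsDominatedBy (G : SimpleGraph V) (k : ℕ) (S : Finset V) (v : V) : Prop :=
  ∃ x ∈ S, G.dist v x ≤ k

/-- `S` is a `k`-truncated resolving set. -/
def IsTruncResolving (G : SimpleGraph V) (k : ℕ) (S : Finset V) : Prop :=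
  ∀ u v : V, u ≠ v → ∃ x ∈ S, G.Distinguishes k x u v

/-- `S` is a `k`-truncated dominating resolving set. -/
def IsTruncDomResolving (G : SimpleGraph V) (k : ℕ) (S : Finset V) : Prop :=
  G.IsTruncResolving k S ∧ ∀ v : V, G.IsDominatedBy k S v

/-- `S` is a `k`-truncated resolving set, and `r` is the only vertex that it does not
`k`-dominate. -/
def IsTruncResolvingExcept (G : SimpleGraph V) (k : ℕ) (r : V) (S : Finset V) : Prop :=
  G.IsTruncResolving k S ∧ ∀ v : V, ¬ G.IsDominatedBy k S v ↔ v = r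

/-- The `k`-truncated metric dimension `dim_k(G)`: the least size of a `k`-truncated
resolving set. (An infimum in `ℕ∞`; for a finite graph it is a natural number.) -/
noncomputable def truncDim (G : SimpleGraph V) (k : ℕ) : ℕ∞ :=
  ⨅ (S : Finset V) (_ : G.IsTruncResolving k S), (S.card : ℕ∞)

/-- `s_mdr`: the least size of a `k`-truncated dominating resolving set. -/
noncomputable def truncDomDim (G : SimpleGraph V) (k : ℕ) : ℕ∞ :=
  ⨅ (S : Finset V) (_ : G.IsTruncDomResolving k S), (S.card : ℕ∞)

/-- `s_min`: the least size, over all vertices `r`, of a `k`-truncated resolving set for which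
`r` is the only vertex that is not `k`-dominated; it is `⊤` if there is no such set. -/
noncomputable def truncExceptDim (G : SimpleGraph V) (k : ℕ) : ℕ∞ :=
  ⨅ (r : V) (S : Finset V) (_ : G.IsTruncResolvingExcept k r S), (S.card : ℕ∞)

/-- `L` is a list of the edges of `G`: every edge occurs exactly once, with its endpoints in
either order; the order of the edges is arbitrary. -/
def IsEdgeList {n : ℕ} (G : SimpleGraph (Fin n)) (L : List (Fin n × Fin n)) : Prop :=
  (L.map fun p => s(p.1, p.2)).Nodup ∧ ∀ e, e ∈ (L.map fun p => s(p.1, p.2)) ↔ e ∈ G.edgeSet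

end SimpleGraph

/-! ### A word RAM with structured programs

A program uses finitely many registers and finitely many arrays, which hold natural numbers.
The arithmetic operations are addition and truncated subtraction. Each of the operations costs
one step, and a computation gets stuck as soon as a number greater than `W` appears. -/

namespace WordRAM

/-- Contents of the registers and of the arrays: `arr a i` is entry `i` of array `a`. -/
structure State where
  reg : ℕ → ℕ
  arr : ℕ → ℕ → ℕ

/-- Expressions: constants, registers, array entries, sums and truncated differences. -/
inductive Expr where
  | lit (c : ℕ)
  | reg (r : ℕ)
  | get (a : ℕ) (i : Expr)
  | add (e₁ e₂ : Expr)
  | sub (e₁ e₂ : Expr)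

/-- The value of an expression. -/
def Expr.eval (s : State) : Expr → ℕ
  | .lit c => c
  | .reg r => s.reg r
  | .get a i => s.arr a (i.eval s)
  | .add e₁ e₂ => e₁.eval s + e₂.eval s
  | .sub e₁ e₂ => e₁.eval s - e₂.eval s

/-- Every number that appears in the evaluation of the expression is at most `W`. -/
def Expr.Fits (W : ℕ) (s : State) : Expr → Prop
  | .lit c => c ≤ W
  | .reg r => s.reg r ≤ W
  | .get a i => i.Fits W s ∧ s.arr a (i.eval s) ≤ W
  | .add e₁ e₂ => e₁.Fits W s ∧ e₂.Fits W s ∧ e₁.eval s + e₂.eval s ≤ W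
  | .sub e₁ e₂ => e₁.Fits W s ∧ e₂.Fits W s

/-- The number of steps that the evaluation takes: one for each operation and operand. -/
def Expr.cost : Expr → ℕ
  | .lit _ => 1
  | .reg _ => 1
  | .get _ i => i.cost + 1
  | .add e₁ e₂ => e₁.cost + e₂.cost + 1
  | .sub e₁ e₂ => e₁.cost + e₂.cost + 1

/-- Programs. A test `e` counts as true if its value is not zero. -/
inductive Prog where
  | skip
  | assign (r : ℕ) (e : Expr)
  | store (a : ℕ) (i e : Expr)
  | seq (p q : Prog)
  | cond (e : Expr) (p q : Prog)
  | loop (e : Expr) (p : Prog)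

/-- Overwrite a register. -/
def State.setReg (s : State) (r x : ℕ) : State :=
  { s with reg := Function.update s.reg r x }

/-- Overwrite an array entry. -/
def State.setArr (s : State) (a i x : ℕ) : State :=
  { s with arr := Function.update s.arr a (Function.update (s.arr a) i x) }

/-- `Run W p s t s'`: with numbers bounded by `W`, the program `p` started in the state `s` halts
in the state `s'` after exactly `t` steps. -/
inductive Run (W : ℕ) : Prog → State → ℕ → State → Prop
  | skip {s : State} : Run W .skip s 1 s
  | assign {s : State} {r : ℕ} {e : Expr} :
      e.Fits W s → Run W (.assign r e) s (e.cost + 1) (s.setReg r (e.eval s))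
  | store {s : State} {a : ℕ} {i e : Expr} :
      i.Fits W s → e.Fits W s →
      Run W (.store a i e) s (i.cost + e.cost + 1) (s.setArr a (i.eval s) (e.eval s))
  | seq {s s' s'' : State} {p q : Prog} {t t' : ℕ} :
      Run W p s t s' → Run W q s' t' s'' → Run W (.seq p q) s (t + t') s''
  | cond_true {s s' : State} {e : Expr} {p q : Prog} {t : ℕ} :
      e.Fits W s → e.eval s ≠ 0 → Run W p s t s' → Run W (.cond e p q) s (e.cost + 1 + t) s'
  | cond_false {s s' : State} {e : Expr} {p q : Prog} {t : ℕ} :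
      e.Fits W s → e.eval s = 0 → Run W q s t s' → Run W (.cond e p q) s (e.cost + 1 + t) s'
  | loop_true {s s' s'' : State} {e : Expr} {p : Prog} {t t' : ℕ} :
      e.Fits W s → e.eval s ≠ 0 → Run W p s t s' → Run W (.loop e p) s' t' s'' →
      Run W (.loop e p) s (e.cost + 1 + t + t') s''
  | loop_false {s : State} {e : Expr} {p : Prog} :
      e.Fits W s → e.eval s = 0 → Run W (.loop e p) s (e.cost + 1) s

/-- The input state for a graph on `{0, …, n - 1}` given by a list of edges: register `0` holds
`n`, and entry `i` of the arrays `0` and `1` holds the endpoints of the `i`-th edge. All else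
is `0`. -/
def inputState {n : ℕ} (L : List (Fin n × Fin n)) : State where
  reg r := if r = 0 then n else 0
  arr a i := if h : i < L.length then
      (if a = 0 then (L[i].1 : ℕ) else if a = 1 then (L[i].2 : ℕ) else 0)
    else 0

/-- The invariant `f` of graphs is computable on trees in time `O(τ(n))`: there is one program
which, for every tree `T` on `{0, …, n - 1}` and every list of its edges, halts after at most
`c * τ n` steps with `f T` in register `0`. The numbers are bounded by a polynomial in `n`,
that is, the words have `O(log n)` bits. -/
def ComputableOnTreesInTime (f : ∀ n : ℕ, SimpleGraph (Fin n) → ℕ∞) (τ : ℕ → ℕ) : Prop :=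
  ∃ (p : Prog) (c : ℕ), ∀ (n : ℕ) (T : SimpleGraph (Fin n)), T.IsTree →
    ∀ L : List (Fin n × Fin n), T.IsEdgeList L →
      ∃ (t : ℕ) (s : State), Run (c * n ^ c) p (inputState L) t s ∧ t ≤ c * τ n ∧
        (s.reg 0 : ℕ∞) = f n T

end WordRAM

/-! The formula for `dim_k` rests on one observation: two vertices not `k`-dominated by `S` both
have truncated distance `k + 1` to every element of `S`, so a resolving set leaves at most one
vertex undominated (`eq_of_not_dominated`).

Both algorithms are one dynamic program over the tree. A bag is a set of vertices attached to the
rest of the tree through a single root. How a set `S` inside a bag acts on pairs of vertices, inside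
or outside, depends only on truncated distances, and these form a finite `Profile k` whose number of
possible values depends on `k` alone. When two bags are joined by an edge between their roots, every
path from one to the other uses that edge, so the profile of the union is a function of the two
profiles (`profile_union`). The least sizes realizing each profile therefore combine by a min-plus
rule over pairs of profiles (`IsCostTable.union`), at constant cost per edge.

The tree is consumed by absorbing leaves into their unique remaining neighbours (`Pruning.leaf`)
until a single bag is left (`Pruning.eq_singleton`). The program keeps for each remaining vertex its
degree and the sum of its remaining neighbours; for a leaf this sum is the neighbour itself, so no
adjacency lists are needed. A cursor passes once over the vertices and follows chains of newly
created leaves, which gives linearly many constant-time steps (`MainInv`, `program_spec`). Being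
resolving or dominating can be read off the final profile. -/

/-! ### Profiles of rooted bags -/

namespace TruncProfile

variable {V : Type*} {k : ℕ}

/-- Truncation of a distance at `k + 1`. -/
def trunc (k a : ℕ) : Fin (k + 2) := ⟨min a (k + 1), by omega⟩

/-- The truncated length of a path that consists of two paths joined by an edge. -/
def glue (a b : Fin (k + 2)) : Fin (k + 2) := trunc k (a + 1 + b)

/-- If either summand reaches the cap `k + 1`, so does the sum. Hence truncated distances to the
roots suffice to compute truncated distances across the joining edge. -/
theorem trunc_add_one_add (a b : ℕ) :
    trunc k (a + 1 + b) = glue (trunc k a) (trunc k b) := by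
  apply Fin.ext
  simp only [glue, trunc]
  omega

/-- What is recorded about two vertices `u`, `v` of a bag with root `r`: their truncated distances
to `r`, whether they are equal, and the truncated distances from `u`, `v` and `r` to the elements
of the chosen set. -/
abbrev PairType (k : ℕ) : Type :=
  Fin (k + 2) × Fin (k + 2) × Prop × Set (Fin (k + 2) × Fin (k + 2) × Fin (k + 2))

/-- The set of the types of all pairs of vertices of a bag. -/
abbrev Profile (k : ℕ) : Type := Set (PairType k)

/-- The type of the pair `u`, `v` with respect to the root `r` and the set `S`. -/
def pairType (d : V → V → ℕ) (k : ℕ) (r : V) (S : Finset V) (u v : V) : PairType k :=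
  (trunc k (d u r), trunc k (d v r), u = v,
    {y | ∃ x ∈ S, (trunc k (d u x), trunc k (d v x), trunc k (d r x)) = y})

/-- The profile of the bag `B` with root `r` and the set `S`. -/
def profile (d : V → V → ℕ) (k : ℕ) (B : Finset V) (r : V) (S : Finset V) : Profile k :=
  {t | ∃ u ∈ B, ∃ v ∈ B, pairType d k r S u v = t}

/-- The truncated distances from the root to the elements of the chosen set. -/
def rootDists (A : Profile k) : Set (Fin (k + 2)) :=
  {z | ∃ t ∈ A, ∃ y ∈ t.2.2.2, y.2.2 = z}

/-- The type in the union of two vertices of the first bag. -/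
def extendLeft (B : Profile k) (t : PairType k) : PairType k :=
  (t.1, t.2.1, t.2.2.1,
    t.2.2.2 ∪ {y | ∃ z ∈ rootDists B, (glue t.1 z, glue t.2.1 z, glue 0 z) = y})

/-- The type in the union of two vertices of the second bag. -/
def extendRight (A : Profile k) (t : PairType k) : PairType k :=
  (glue 0 t.1, glue 0 t.2.1, t.2.2.1,
    {y | ∃ z ∈ rootDists A, (glue z t.1, glue z t.2.1, z) = y} ∪
      {y | ∃ x ∈ t.2.2.2, (x.1, x.2.1, glue 0 x.2.2) = y})

/-- The type in the union of a vertex of the first bag and a vertex of the second bag. -/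
def crossType (t t' : PairType k) : PairType k :=
  (t.1, glue 0 t'.1, False,
    {y | ∃ x ∈ t.2.2.2, (x.1, glue x.2.2 t'.1, x.2.2) = y} ∪
      {y | ∃ x ∈ t'.2.2.2, (glue t.1 x.2.2, x.1, glue 0 x.2.2) = y})

/-- The type of the pair in the opposite order. -/
def swapType (t : PairType k) : PairType k :=
  (t.2.1, t.1, t.2.2.1, {y | ∃ x ∈ t.2.2.2, (x.2.1, x.1, x.2.2) = y})

/-- The profile of the union of two bags joined by an edge between their roots. -/
def merge (A B : Profile k) : Profile k :=
  {t | ∃ p ∈ A, extendLeft B p = t} ∪ {t | ∃ p ∈ B, extendRight A p = t} ∪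
    ({t | ∃ p ∈ A, ∃ p' ∈ B, crossType p p' = t} ∪
      {t | ∃ p ∈ A, ∃ p' ∈ B, swapType (crossType p p') = t})

/-- Every pair type lists all of `S`, so any one type shows these distances; `r ∈ B` guarantees that
the profile contains a type. -/
theorem mem_rootDists_profile {d : V → V → ℕ} {B : Finset V} {r : V} {S : Finset V}
    (hr : r ∈ B) (z : Fin (k + 2)) :
    z ∈ rootDists (profile d k B r S) ↔ ∃ x ∈ S, trunc k (d r x) = z := by
  constructor
  · rintro ⟨_, ⟨u, -, v, -, rfl⟩, _, ⟨x, hx, rfl⟩, rfl⟩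
    exact ⟨x, hx, rfl⟩
  · rintro ⟨x, hx, rfl⟩
    exact ⟨_, ⟨r, hr, r, hr, rfl⟩, _, ⟨x, hx, rfl⟩, rfl⟩

theorem pairType_swap (d : V → V → ℕ) (r : V) (S : Finset V) (u v : V) :
    pairType d k r S v u = swapType (pairType d k r S u v) := by
  simp only [pairType, swapType, eq_comm (a := v) (b := u)]
  refine Prod.ext rfl (Prod.ext rfl (Prod.ext rfl (Set.ext fun y => ?_)))
  simp

section Merge

variable [DecidableEq V] {d : V → V → ℕ} {B₁ B₂ S₁ S₂ : Finset V} {r₁ r₂ : V}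

/-- By `hd`, distances between the bags factor through the joined roots, so each pair type in the
union is computable from recorded data. The four parts of `merge` correspond to the possible
positions of the ordered pair. -/
theorem profile_union (hsymm : ∀ u v, d u v = d v u) (hself : d r₁ r₁ = 0)
    (h₁ : r₁ ∈ B₁) (h₂ : r₂ ∈ B₂) (hS₁ : S₁ ⊆ B₁) (hS₂ : S₂ ⊆ B₂) (hdisj : Disjoint B₁ B₂)
    (hd : ∀ u ∈ B₁, ∀ x ∈ B₂, d u x = d u r₁ + 1 + d r₂ x) :
    profile d k (B₁ ∪ B₂) r₁ (S₁ ∪ S₂) =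
      merge (profile d k B₁ r₁ S₁) (profile d k B₂ r₂ S₂) := by
  have t12 : ∀ u ∈ B₁, ∀ x ∈ B₂,
      trunc k (d u x) = glue (trunc k (d u r₁)) (trunc k (d r₂ x)) := fun u hu x hx => by
    rw [hd u hu x hx, trunc_add_one_add]
  have t21 : ∀ u ∈ B₂, ∀ x ∈ B₁,
      trunc k (d u x) = glue (trunc k (d r₁ x)) (trunc k (d u r₂)) := fun u hu x hx => by
    rw [hsymm u x, hd x hx u hu, trunc_add_one_add, hsymm x r₁, hsymm r₂ u]
  have t0 : trunc k (d r₁ r₁) = 0 := by rw [hself]; apply Fin.ext; simp [trunc]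
  have tr : ∀ x ∈ B₂, trunc k (d r₁ x) = glue 0 (trunc k (d r₂ x)) := fun x hx => by
    rw [t12 r₁ h₁ x hx, t0]
  have tr' : ∀ u ∈ B₂, trunc k (d u r₁) = glue 0 (trunc k (d u r₂)) := fun x hx => by
    rw [hsymm, tr x hx, hsymm]
  have hLL : ∀ u ∈ B₁, ∀ v ∈ B₁, pairType d k r₁ (S₁ ∪ S₂) u v =
      extendLeft (profile d k B₂ r₂ S₂) (pairType d k r₁ S₁ u v) := by
    intro u hu v hv
    refine Prod.ext rfl (Prod.ext rfl (Prod.ext rfl (Set.ext fun y => ?_)))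
    simp only [pairType, extendLeft, Set.mem_union, Set.mem_ofPred_eq, Finset.mem_union,
      mem_rootDists_profile h₂, or_and_right, exists_or, exists_exists_and_eq_and]
    refine or_congr Iff.rfl (exists_congr fun x => and_congr_right fun hx => ?_)
    rw [t12 u hu x (hS₂ hx), t12 v hv x (hS₂ hx), tr x (hS₂ hx)]
  have hRR : ∀ u ∈ B₂, ∀ v ∈ B₂, pairType d k r₁ (S₁ ∪ S₂) u v =
      extendRight (profile d k B₁ r₁ S₁) (pairType d k r₂ S₂ u v) := by
    intro u hu v hv
    refine Prod.ext (tr' u hu) (Prod.ext (tr' v hv) (Prod.ext rfl (Set.ext fun y => ?_)))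
    simp only [pairType, extendRight, Set.mem_union, Set.mem_ofPred_eq, Finset.mem_union,
      mem_rootDists_profile h₁, or_and_right, exists_or, exists_exists_and_eq_and]
    refine or_congr (exists_congr fun x => and_congr_right fun hx => ?_)
      (exists_congr fun x => and_congr_right fun hx => ?_)
    · rw [t21 u hu x (hS₁ hx), t21 v hv x (hS₁ hx)]
    · rw [tr x (hS₂ hx)]
  -- The partners `u'` and `v'` are arbitrary because `crossType` reads only the data of the first
  -- vertex and of the root from each type.
  have hLR : ∀ u ∈ B₁, ∀ v ∈ B₂, ∀ u' v', pairType d k r₁ (S₁ ∪ S₂) u v =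
      crossType (pairType d k r₁ S₁ u u') (pairType d k r₂ S₂ v v') := by
    intro u hu v hv u' v'
    have hne : (u = v) = False :=
      eq_false fun h => Finset.disjoint_left.1 hdisj hu (h ▸ hv)
    refine Prod.ext rfl (Prod.ext (tr' v hv) (Prod.ext hne (Set.ext fun y => ?_)))
    simp only [pairType, crossType, Set.mem_union, Set.mem_ofPred_eq, Finset.mem_union,
      or_and_right, exists_or, exists_exists_and_eq_and]
    refine or_congr (exists_congr fun x => and_congr_right fun hx => ?_)
      (exists_congr fun x => and_congr_right fun hx => ?_)
    · rw [t21 v hv x (hS₁ hx)]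
    · rw [t12 u hu x (hS₂ hx), tr x (hS₂ hx)]
  apply Set.Subset.antisymm
  · rintro _ ⟨u, hu, v, hv, rfl⟩
    rcases Finset.mem_union.1 hu with hu | hu <;> rcases Finset.mem_union.1 hv with hv | hv
    · exact .inl (.inl ⟨_, ⟨u, hu, v, hv, rfl⟩, (hLL u hu v hv).symm⟩)
    · exact .inr (.inl ⟨_, ⟨u, hu, u, hu, rfl⟩, _, ⟨v, hv, v, hv, rfl⟩,
        (hLR u hu v hv _ _).symm⟩)
    · refine .inr (.inr ⟨_, ⟨v, hv, v, hv, rfl⟩, _, ⟨u, hu, u, hu, rfl⟩, ?_⟩)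
      rw [← hLR v hv u hu, ← pairType_swap]
    · exact .inl (.inr ⟨_, ⟨u, hu, v, hv, rfl⟩, (hRR u hu v hv).symm⟩)
  · have hl : ∀ {x}, x ∈ B₁ → x ∈ B₁ ∪ B₂ := fun h => Finset.mem_union_left _ h
    have hr : ∀ {x}, x ∈ B₂ → x ∈ B₁ ∪ B₂ := fun h => Finset.mem_union_right _ h
    rintro _ ((⟨_, ⟨u, hu, v, hv, rfl⟩, rfl⟩ | ⟨_, ⟨u, hu, v, hv, rfl⟩, rfl⟩) |
      (⟨_, ⟨u, hu, u', -, rfl⟩, _, ⟨v, hv, v', -, rfl⟩, rfl⟩ |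
        ⟨_, ⟨u, hu, u', -, rfl⟩, _, ⟨v, hv, v', -, rfl⟩, rfl⟩))
    · exact ⟨u, hl hu, v, hl hv, hLL u hu v hv⟩
    · exact ⟨u, hr hu, v, hr hv, hRR u hu v hv⟩
    · exact ⟨u, hl hu, v, hr hv, hLR u hu v hv _ _⟩
    · exact ⟨v, hr hv, u, hl hu, by rw [pairType_swap, hLR u hu v hv]⟩

end Merge

/-! ### Cost tables of bags -/

/-- `D q` is the least size of a set `S ⊆ B` with profile `q`; sizes above `n` are represented
by `n + 1`. -/
def IsCostTable (d : V → V → ℕ) (k n : ℕ) (B : Finset V) (r : V) (D : Profile k → ℕ) : Prop :=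
  ∀ q, D q ≤ n + 1 ∧
    ∀ c ≤ n, D q ≤ c ↔ ∃ S ⊆ B, profile d k B r S = q ∧ S.card ≤ c

/-- A set in the union splits uniquely into its traces on the two disjoint bags; sizes add and
profiles merge. -/
theorem IsCostTable.union [DecidableEq V] {d : V → V → ℕ} {n : ℕ} {B₁ B₂ : Finset V} {r₁ r₂ : V}
    {D₁ D₂ D : Profile k → ℕ} (hD₁ : IsCostTable d k n B₁ r₁ D₁) (hD₂ : IsCostTable d k n B₂ r₂ D₂)
    (hsymm : ∀ u v, d u v = d v u) (hself : d r₁ r₁ = 0)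
    (h₁ : r₁ ∈ B₁) (h₂ : r₂ ∈ B₂) (hdisj : Disjoint B₁ B₂)
    (hd : ∀ u ∈ B₁, ∀ x ∈ B₂, d u x = d u r₁ + 1 + d r₂ x)
    (hle : ∀ q, D q ≤ n + 1)
    (hD : ∀ q, ∀ c ≤ n, D q ≤ c ↔ ∃ q₁ q₂, merge q₁ q₂ = q ∧ D₁ q₁ + D₂ q₂ ≤ c) :
    IsCostTable d k n (B₁ ∪ B₂) r₁ D := by
  refine fun q => ⟨hle q, fun c hc => (hD q c hc).trans ⟨?_, ?_⟩⟩
  · rintro ⟨q₁, q₂, rfl, hq⟩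
    -- The sum is at most `c ≤ n`, so neither cost is the overflow value `n + 1` and both are
    -- realized by sets.
    obtain ⟨S₁, hS₁, rfl, c₁⟩ := ((hD₁ q₁).2 (D₁ q₁) (by omega)).1 le_rfl
    obtain ⟨S₂, hS₂, rfl, c₂⟩ := ((hD₂ q₂).2 (D₂ q₂) (by omega)).1 le_rfl
    refine ⟨S₁ ∪ S₂, Finset.union_subset_union hS₁ hS₂,
      profile_union hsymm hself h₁ h₂ hS₁ hS₂ hdisj hd, ?_⟩
    have := Finset.card_union_le S₁ S₂
    omega
  · rintro ⟨S, hS, rfl, hc'⟩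
    have e : S = S ∩ B₁ ∪ S ∩ B₂ := by
      rw [← Finset.inter_union_distrib_left, Finset.inter_eq_left.2 hS]
    have hcard : S.card = (S ∩ B₁).card + (S ∩ B₂).card := by
      conv_lhs => rw [e]
      exact Finset.card_union_of_disjoint
        (hdisj.mono Finset.inter_subset_right Finset.inter_subset_right)
    refine ⟨profile d k B₁ r₁ (S ∩ B₁), profile d k B₂ r₂ (S ∩ B₂), ?_, ?_⟩
    · rw [← profile_union hsymm hself h₁ h₂ Finset.inter_subset_right Finset.inter_subset_right
        hdisj hd, ← e]
    · have a := ((hD₁ (profile d k B₁ r₁ (S ∩ B₁))).2 (S ∩ B₁).card (by omega)).2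
        ⟨_, Finset.inter_subset_right, rfl, le_rfl⟩
      have b := ((hD₂ (profile d k B₂ r₂ (S ∩ B₂))).2 (S ∩ B₂).card (by omega)).2
        ⟨_, Finset.inter_subset_right, rfl, le_rfl⟩
      omega

/-- The profile of a single vertex that is not chosen. -/
def leafOut (k : ℕ) : Profile k := {(0, 0, True, ∅)}

/-- The profile of a single chosen vertex. -/
def leafIn (k : ℕ) : Profile k := {(0, 0, True, {(0, 0, 0)})}

open Classical in
/-- The cost table of a single vertex. -/
noncomputable def leafCost (k n : ℕ) (q : Profile k) : ℕ :=
  if q = leafOut k then 0 else if q = leafIn k then 1 else n + 1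

theorem isCostTable_singleton [DecidableEq V] {d : V → V → ℕ} {n : ℕ} (hn : 1 ≤ n) {v : V}
    (hv : d v v = 0) : IsCostTable d k n {v} v (leafCost k n) := by
  have t0 : trunc k 0 = 0 := by apply Fin.ext; simp [trunc]
  have e0 : profile d k {v} v ∅ = leafOut k := by
    ext t; simp [profile, pairType, leafOut, hv, t0, eq_comm]
  have e1 : profile d k {v} v {v} = leafIn k := by
    ext t
    simp only [profile, pairType, leafIn, hv, t0, Finset.mem_singleton, exists_eq_left,
      Set.mem_ofPred_eq, Set.mem_singleton_iff]
    rw [eq_comm]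
    have : {y : Fin (k + 2) × Fin (k + 2) × Fin (k + 2) | (0, 0, 0) = y} = {(0, 0, 0)} := by
      ext y; simp [eq_comm]
    rw [this]
  intro q
  unfold leafCost
  refine ⟨by split_ifs <;> omega, fun c hc => ⟨fun h => ?_, ?_⟩⟩
  · split_ifs at h with h0 h1
    · exact ⟨∅, by simp, by rw [e0, h0], by simp⟩
    · exact ⟨{v}, by simp, by rw [e1, h1], by simpa using h⟩
    · omega
  · rintro ⟨S, hS, rfl, hSc⟩
    rcases Finset.subset_singleton_iff.1 hS with rfl | rfl
    · simp [e0]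
    · rw [e1]
      rw [if_pos (rfl : leafIn k = leafIn k)]
      rw [Finset.card_singleton] at hSc
      split_ifs <;> omega

/-! ### Recognizing resolving and dominating sets from the profile -/

/-- The profiles of resolving sets. -/
def Resolves (q : Profile k) : Prop :=
  ∀ t ∈ q, ¬ t.2.2.1 → ∃ y ∈ t.2.2.2, y.1 ≠ y.2.1

/-- The profiles of dominating sets. -/
def Dominates (q : Profile k) : Prop :=
  ∀ t ∈ q, ∃ y ∈ t.2.2.2, y.1.val ≤ k

theorem resolves_profile_iff [Fintype V] (G : SimpleGraph V) (r : V) (S : Finset V) :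
    Resolves (profile G.dist k Finset.univ r S) ↔ G.IsTruncResolving k S := by
  constructor
  · intro h u v huv
    obtain ⟨_, ⟨x, hx, rfl⟩, hne⟩ := h _ ⟨u, Finset.mem_univ u, v, Finset.mem_univ v, rfl⟩ huv
    refine ⟨x, hx, fun he => hne (Fin.ext ?_)⟩
    simpa [SimpleGraph.truncDist, trunc] using he
  · rintro h _ ⟨u, -, v, -, rfl⟩ huv
    obtain ⟨x, hx, hne⟩ := h u v huv
    refine ⟨_, ⟨x, hx, rfl⟩, fun he => hne ?_⟩
    simpa [SimpleGraph.truncDist, trunc] using congrArg Fin.val he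

/-- The cap `k + 1` exceeds `k`, so comparing a truncated distance with `k` loses nothing. -/
theorem dominates_profile_iff [Fintype V] (G : SimpleGraph V) (r : V) (S : Finset V) :
    Dominates (profile G.dist k Finset.univ r S) ↔ ∀ v, G.IsDominatedBy k S v := by
  constructor
  · intro h u
    obtain ⟨_, ⟨x, hx, rfl⟩, hle⟩ := h _ ⟨u, Finset.mem_univ u, u, Finset.mem_univ u, rfl⟩
    refine ⟨x, hx, ?_⟩
    simp only [trunc] at hle
    omega
  · rintro h _ ⟨u, -, v, -, rfl⟩
    obtain ⟨x, hx, hle⟩ := h u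
    refine ⟨_, ⟨x, hx, rfl⟩, ?_⟩
    simp only [trunc]
    omega

end TruncProfile

/-! ### Pruning leaves -/

namespace SimpleGraph

variable {V : Type*} {G : SimpleGraph V} [DecidableRel G.Adj]

/-- The neighbours of `v` in `A`. -/
def nbrsIn (G : SimpleGraph V) [DecidableRel G.Adj] (A : Finset V) (v : V) : Finset V :=
  A.filter (G.Adj v)

theorem mem_nbrsIn {A : Finset V} {v w : V} : w ∈ G.nbrsIn A v ↔ w ∈ A ∧ G.Adj v w :=
  Finset.mem_filter

/-- A stage of the successive removal of leaves: `A` is the set of remaining vertices, and each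
vertex `x` has been absorbed by the remaining vertex `b x`. -/
structure Pruning (G : SimpleGraph V) [DecidableRel G.Adj] (A : Finset V) (b : V → V) : Prop where
  owner_mem : ∀ x, b x ∈ A
  owner_self : ∀ v ∈ A, b v = v
  dist_eq : ∀ x y, b x ≠ b y →
    G.dist x y = G.dist x (b x) + G.dist (b x) (b y) + G.dist (b y) y
  -- Between remaining vertices, some geodesic of the whole graph starts inside `A`.
  step : ∀ v ∈ A, ∀ w ∈ A, v ≠ w → ∃ u ∈ G.nbrsIn A v, G.dist v w = 1 + G.dist u w
  -- The handshake identity for a tree with `A.card - 1` edges, written without subtraction.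
  sum_degree : ∑ v ∈ A, (G.nbrsIn A v).card + 2 = 2 * A.card

/-- The vertices absorbed by `v`. -/
def bag [Fintype V] [DecidableEq V] (b : V → V) (v : V) : Finset V := Finset.univ.filter (b · = v)

theorem mem_bag [Fintype V] [DecidableEq V] {b : V → V} {v x : V} : x ∈ bag b v ↔ b x = v := by simp [bag]

theorem pruning_id [Fintype V] [DecidableEq V] (hG : G.IsTree) : G.Pruning Finset.univ id where
  owner_mem _ := Finset.mem_univ _
  owner_self _ _ := rfl
  dist_eq x y _ := by simp
  step v _ w _ hvw := by
    obtain ⟨p, hp⟩ := hG.connected.exists_walk_length_eq_dist v w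
    cases p with
    | nil => exact absurd rfl hvw
    | @cons _ u _ h p =>
      refine ⟨u, mem_nbrsIn.2 ⟨Finset.mem_univ _, h⟩, ?_⟩
      have h1 := dist_le p
      have h2 := hG.connected.dist_triangle (u := v) (v := u) (w := w)
      rw [dist_eq_one_iff_adj.2 h] at h2
      simp only [Walk.length_cons] at hp
      omega
  sum_degree := by
    have h1 := G.sum_degrees_eq_twice_card_edges
    have h2 := hG.card_edgeFinset
    have h3 : ∀ v, (G.nbrsIn Finset.univ v).card = G.degree v := fun v => by
      rw [← card_neighborFinset_eq_degree]
      congr 1; ext w; simp [mem_nbrsIn]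
    simp only [h3, h1, Finset.card_univ]
    omega

theorem nbrsIn_erase [DecidableEq V] {A : Finset V} {v w : V} :
    G.nbrsIn (A.erase v) w = (G.nbrsIn A w).erase v := by
  ext x; simp [mem_nbrsIn, and_assoc]

namespace Pruning

variable {A : Finset V} {b : V → V}

theorem mem_bag_self [Fintype V] [DecidableEq V] (h : G.Pruning A b) {v : V} (hv : v ∈ A) : v ∈ bag b v :=
  mem_bag.2 (h.owner_self v hv)

theorem dist_bag [Fintype V] [DecidableEq V] (h : G.Pruning A b) {v p : V} (hvp : G.Adj p v) :
    ∀ u ∈ bag b p, ∀ x ∈ bag b v, G.dist u x = G.dist u p + 1 + G.dist v x := by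
  intro u hu x hx
  have := h.dist_eq u x (by rw [mem_bag.1 hu, mem_bag.1 hx]; exact hvp.ne)
  rwa [mem_bag.1 hu, mem_bag.1 hx, dist_eq_one_iff_adj.2 hvp] at this

theorem dist_leaf (h : G.Pruning A b) {v p : V} (hv : v ∈ A) (hp : G.nbrsIn A v = {p}) {w : V}
    (hw : w ∈ A) (hvw : v ≠ w) : G.dist v w = 1 + G.dist p w := by
  obtain ⟨u, hu, e⟩ := h.step v hv w hw hvw
  rw [hp, Finset.mem_singleton] at hu
  rw [e, hu]

theorem bag_leaf [Fintype V] [DecidableEq V] (b : V → V) {v p : V} (hvp : v ≠ p) (u : V) :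
    bag (fun x => if b x = v then p else b x) u =
      if u = v then ∅ else if u = p then bag b p ∪ bag b v else bag b u := by
  ext x
  split_ifs with h1 h2
  · subst h1
    simp only [mem_bag, Finset.notMem_empty, iff_false]
    split_ifs with h <;> [exact hvp.symm; exact h]
  · subst h2
    simp only [mem_bag, Finset.mem_union]
    split_ifs with h <;> simp [h]
  · simp only [mem_bag]
    split_ifs with h
    · exact ⟨fun e => absurd e.symm h2, fun e => absurd (e.symm.trans h) h1⟩
    · rfl

/-- All routes from a leaf `v` to other remaining vertices pass through `p`, so `p` can take over
the bag of `v`. -/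
theorem leaf [DecidableEq V] (h : G.Pruning A b) {v p : V} (hv : v ∈ A) (hp : G.nbrsIn A v = {p}) :
    G.Pruning (A.erase v) (fun x => if b x = v then p else b x) := by
  obtain ⟨hpA, hadj⟩ := mem_nbrsIn.1 (hp ▸ Finset.mem_singleton_self p : p ∈ G.nbrsIn A v)
  have hvp : v ≠ p := hadj.ne
  have key : ∀ x y, b x = v → b y ≠ v → G.dist x y =
      G.dist x p + G.dist p (b y) + G.dist (b y) y := by
    intro x y hx hy
    have h1 := h.dist_eq x y (by rw [hx]; exact hy.symm)
    have h2 := h.dist_eq x p (by rw [hx, h.owner_self p hpA]; exact hvp)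
    have h3 := h.dist_leaf hv hp (h.owner_mem y) hy.symm
    rw [hx] at h1 h2
    rw [h.owner_self p hpA, dist_self, dist_eq_one_iff_adj.2 hadj] at h2
    omega
  refine ⟨fun x => ?_, fun w hw => ?_, fun x y hxy => ?_, fun u hu w hw huw => ?_, ?_⟩
  · split_ifs with hx
    · exact Finset.mem_erase.2 ⟨hvp.symm, hpA⟩
    · exact Finset.mem_erase.2 ⟨hx, h.owner_mem x⟩
  · obtain ⟨h1, h2⟩ := Finset.mem_erase.1 hw
    rw [h.owner_self w h2, if_neg h1]
  · by_cases hx : b x = v <;> by_cases hy : b y = v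
    · simp [hx, hy] at hxy
    · rw [if_pos hx, if_neg hy]
      exact key x y hx hy
    · rw [if_neg hx, if_pos hy]
      have := key y x hy hx
      rw [dist_comm, this, dist_comm (u := b x) (v := x), dist_comm (u := y) (v := p),
        dist_comm (u := b x) (v := p)]
      omega
    · rw [if_neg hx, if_neg hy] at hxy ⊢
      exact h.dist_eq x y hxy
  · obtain ⟨huv, huA⟩ := Finset.mem_erase.1 hu
    obtain ⟨hwv, hwA⟩ := Finset.mem_erase.1 hw
    obtain ⟨x, hx, e⟩ := h.step u huA w hwA huw
    refine ⟨x, ?_, e⟩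
    rw [nbrsIn_erase]
    refine Finset.mem_erase.2 ⟨fun hxv => ?_, hx⟩
    -- A geodesic from `u` to `w` cannot begin with the leaf: its only neighbour would be `u`, and
    -- each of `u` and the leaf would be closer to `w` than the other.
    subst hxv
    have : u ∈ G.nbrsIn A x := mem_nbrsIn.2 ⟨huA, (mem_nbrsIn.1 hx).2.symm⟩
    rw [hp, Finset.mem_singleton] at this
    subst this
    have := h.dist_leaf hv hp hwA (Ne.symm hwv)
    omega
  -- The degree sum drops by two: the degree one of `v`, and one at `p`.
  · have h1 := h.sum_degree
    rw [← Finset.add_sum_erase A _ hv, hp, Finset.card_singleton] at h1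
    have hp' : p ∈ A.erase v := Finset.mem_erase.2 ⟨hvp.symm, hpA⟩
    rw [← Finset.add_sum_erase _ _ hp'] at h1 ⊢
    have h2 : ∀ w ∈ (A.erase v).erase p,
        (G.nbrsIn (A.erase v) w).card = (G.nbrsIn A w).card := by
      intro w hw
      obtain ⟨hwp, hw⟩ := Finset.mem_erase.1 hw
      rw [nbrsIn_erase, Finset.erase_eq_of_notMem]
      intro hvw
      have : w ∈ G.nbrsIn A v :=
        mem_nbrsIn.2 ⟨(Finset.mem_erase.1 hw).2, (mem_nbrsIn.1 hvw).2.symm⟩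
      rw [hp, Finset.mem_singleton] at this
      exact hwp this
    have h3 : (G.nbrsIn (A.erase v) p).card + 1 = (G.nbrsIn A p).card := by
      rw [nbrsIn_erase]
      exact Finset.card_erase_add_one (mem_nbrsIn.2 ⟨hv, hadj.symm⟩)
    rw [Finset.sum_congr rfl h2]
    have h4 := Finset.card_erase_add_one hv
    omega

/-- With two remaining vertices, `step` gives every vertex a neighbour in `A`; without leaves all
degrees are at least two, contradicting the degree sum `2 * A.card - 2`. -/
theorem eq_singleton (h : G.Pruning A b) {r : V} (hr : r ∈ A)
    (hleaf : ∀ v ∈ A, (G.nbrsIn A v).card ≠ 1) : A = {r} := by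
  by_contra hne
  obtain ⟨w, hw, hwr⟩ : ∃ w ∈ A, w ≠ r := by
    by_contra! hc
    exact hne (Finset.eq_singleton_iff_unique_mem.2 ⟨hr, hc⟩)
  have h2 : ∀ v ∈ A, 2 ≤ (G.nbrsIn A v).card := by
    intro v hv
    obtain ⟨u, hu, huv⟩ : ∃ u ∈ A, v ≠ u := by
      by_cases hvr : v = r
      · exact ⟨w, hw, by rw [hvr]; exact hwr.symm⟩
      · exact ⟨r, hr, hvr⟩
    obtain ⟨x, hx, -⟩ := h.step v hv u hu huv
    have := Finset.card_pos.2 ⟨x, hx⟩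
    have := hleaf v hv
    omega
  have h3 := Finset.card_nsmul_le_sum A (fun v => (G.nbrsIn A v).card) 2 h2
  have h4 := h.sum_degree
  simp only [smul_eq_mul] at h3
  omega

end Pruning

end SimpleGraph

/-! ### Reasoning about programs -/

namespace WordRAM

/-- The effect of a program without loops. -/
def Prog.exec : Prog → State → State
  | .skip, s => s
  | .assign r e, s => s.setReg r (e.eval s)
  | .store a i e, s => s.setArr a (i.eval s) (e.eval s)
  | .seq p q, s => q.exec (p.exec s)
  | .cond e p q, s => if e.eval s ≠ 0 then p.exec s else q.exec s
  | .loop _ _, s => s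

/-- The program has no loops, and all numbers in its computation are at most `W`. -/
def Prog.Safe (W : ℕ) : Prog → State → Prop
  | .skip, _ => True
  | .assign _ e, s => e.Fits W s
  | .store _ i e, s => i.Fits W s ∧ e.Fits W s
  | .seq p q, s => p.Safe W s ∧ q.Safe W (p.exec s)
  | .cond e p q, s =>
    e.Fits W s ∧ (e.eval s ≠ 0 → p.Safe W s) ∧ (e.eval s = 0 → q.Safe W s)
  | .loop _ _, _ => False

/-- A bound on the number of steps of a program without loops. -/
def Prog.bound : Prog → ℕ
  | .skip => 1
  | .assign _ e => e.cost + 1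
  | .store _ i e => i.cost + e.cost + 1
  | .seq p q => p.bound + q.bound
  | .cond e p q => e.cost + 1 + (p.bound + q.bound)
  | .loop _ _ => 0

theorem Prog.Safe.run {W : ℕ} : ∀ {p : Prog} {s : State}, p.Safe W s →
    ∃ t ≤ p.bound, Run W p s t (p.exec s)
  | .skip, _, _ => ⟨1, le_rfl, .skip⟩
  | .assign _ _, _, h => ⟨_, le_rfl, .assign h⟩
  | .store _ _ _, _, h => ⟨_, le_rfl, .store h.1 h.2⟩
  | .seq _ _, _, h => by
    obtain ⟨t₁, h₁, r₁⟩ := h.1.run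
    obtain ⟨t₂, h₂, r₂⟩ := h.2.run
    exact ⟨_, Nat.add_le_add h₁ h₂, .seq r₁ r₂⟩
  | .cond e p q, s, h => by
    by_cases he : e.eval s = 0
    · obtain ⟨t, ht, r⟩ := (h.2.2 he).run
      refine ⟨e.cost + 1 + t, by simp only [Prog.bound]; omega, ?_⟩
      simpa [Prog.exec, he] using Run.cond_false h.1 he r
    · obtain ⟨t, ht, r⟩ := (h.2.1 he).run
      refine ⟨e.cost + 1 + t, by simp only [Prog.bound]; omega, ?_⟩
      simpa [Prog.exec, he] using Run.cond_true h.1 he r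
  | .loop _ _, _, h => h.elim

/-- A loop whose body has no loops and decreases a measure. -/
theorem run_loop {W : ℕ} {e : Expr} {p : Prog} (I : ℕ → State → Prop)
    (hfits : ∀ m s, I m s → e.Fits W s)
    (hbody : ∀ m s, I m s → e.eval s ≠ 0 → p.Safe W s ∧ ∃ m' < m, I m' (p.exec s)) :
    ∀ m s, I m s → ∃ t ≤ (m + 1) * (e.cost + 1 + p.bound), ∃ m' s',
      Run W (.loop e p) s t s' ∧ I m' s' ∧ e.eval s' = 0 := by
  intro m
  induction m using Nat.strong_induction_on with
  | _ m ih =>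
    intro s hs
    by_cases he : e.eval s = 0
    · refine ⟨e.cost + 1, ?_, m, s, .loop_false (hfits m s hs) he, hs, he⟩
      nlinarith
    · obtain ⟨hsafe, m', hm', hI⟩ := hbody m s hs he
      obtain ⟨t₁, ht₁, r₁⟩ := hsafe.run
      obtain ⟨t₂, ht₂, m'', s'', r₂, hI', he'⟩ := ih m' hm' _ hI
      refine ⟨_, ?_, m'', s'', .loop_true (hfits m s hs) he r₁ r₂, hI', he'⟩
      have : (m' + 1) * (e.cost + 1 + p.bound) ≤ m * (e.cost + 1 + p.bound) :=
        Nat.mul_le_mul_right _ hm'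
      have h2 : (m + 1) * (e.cost + 1 + p.bound) =
        m * (e.cost + 1 + p.bound) + (e.cost + 1 + p.bound) := by ring
      omega

/-- The programs of a list, one after the other. -/
def Prog.block : List Prog → Prog
  | [] => .skip
  | p :: l => .seq p (block l)

/-- Replace register `r` by its minimum with the value of `e`. -/
def Prog.relax (p : ℕ × Expr) : Prog :=
  .cond (.sub (.reg p.1) p.2) (.assign p.1 p.2) .skip

/-- The two states have the same arrays and agree in the registers below `N`. -/
def State.Agree (N : ℕ) (s s' : State) : Prop :=
  s'.arr = s.arr ∧ ∀ r < N, s'.reg r = s.reg r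

theorem State.Agree.setReg {N : ℕ} {s s' : State} (h : s.Agree N s') {r : ℕ} (hr : N ≤ r) (x : ℕ) :
    s.Agree N (s'.setReg r x) := by
  refine ⟨h.1, fun r' hr' => ?_⟩
  have : r' ≠ r := by omega
  simp [State.setReg, this, h.2 r' hr']

/-- Targets lie at or above `N`, while the expressions depend only on the arrays and the registers
below `N`; so every comparison sees the values of `s₀`. The minimum is described by its upper bounds
`c`, which also handles several items with the same target. -/
theorem relaxAll_spec {N W : ℕ} {s₀ : State} : ∀ (l : List (ℕ × Expr)),
    (∀ p ∈ l, N ≤ p.1 ∧ ∀ s, s₀.Agree N s → p.2.eval s = p.2.eval s₀ ∧ p.2.Fits W s) →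
    ∀ s, s₀.Agree N s → (∀ p ∈ l, s.reg p.1 ≤ W) →
      (Prog.block (l.map Prog.relax)).Safe W s ∧
      s₀.Agree N ((Prog.block (l.map Prog.relax)).exec s) ∧
      ∀ r c, ((Prog.block (l.map Prog.relax)).exec s).reg r ≤ c ↔
        s.reg r ≤ c ∨ ∃ e, (r, e) ∈ l ∧ e.eval s₀ ≤ c := by
  intro l
  induction l with
  | nil => intro _ s hs _; exact ⟨trivial, hs, by simp [Prog.block, Prog.exec]⟩
  | cons p l ih =>
    intro hl s hs hW
    obtain ⟨hN, hp⟩ := hl p (by simp)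
    obtain ⟨hev, hfit⟩ := hp s hs
    have hmin : ∀ r, ((Prog.relax p).exec s).reg r =
        if r = p.1 then min (s.reg r) (p.2.eval s₀) else s.reg r := by
      intro r
      simp only [Prog.relax, Prog.exec, Expr.eval, hev]
      split_ifs with h1 h2 h2
      · subst h2; simp [State.setReg]; omega
      · simp [State.setReg, h2]
      · subst h2; omega
      · rfl
    have hag : s₀.Agree N ((Prog.relax p).exec s) := by
      simp only [Prog.relax, Prog.exec]
      split_ifs
      · exact hs.setReg hN _
      · exact hs
    obtain ⟨i1, i2, i3⟩ := ih (fun q hq => hl q (by simp [hq])) _ hag (fun q hq => by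
      have := hW q (by simp [hq])
      rw [hmin]
      split_ifs <;> omega)
    refine ⟨⟨⟨⟨hW p (by simp), hfit⟩, fun _ => hfit, fun _ => trivial⟩, i1⟩, i2, fun r c => ?_⟩
    refine (i3 r c).trans ?_
    rw [hmin]
    constructor
    · rintro (h | ⟨e, he, hc⟩)
      · split_ifs at h with hr
        · rcases min_le_iff.1 h with h | h
          · exact .inl h
          · exact .inr ⟨p.2, by simp [hr], h⟩
        · exact .inl h
      · exact .inr ⟨e, by simp [he], hc⟩
    · rintro (h | ⟨e, he, hc⟩)
      · left; split_ifs <;> omega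
      · rcases List.mem_cons.1 he with rfl | he
        · left; simp [hc]
        · exact .inr ⟨e, he, hc⟩

theorem assignAll_spec {N W : ℕ} {ι : Type*} (r : ι → ℕ) (e : Expr) {s₀ : State}
    (he : ∀ s, s₀.Agree N s → e.eval s = e.eval s₀ ∧ e.Fits W s) (hr : ∀ q, N ≤ r q) :
    ∀ (l : List ι) (s : State), s₀.Agree N s →
      (Prog.block (l.map fun q => .assign (r q) e)).Safe W s ∧
      s₀.Agree N ((Prog.block (l.map fun q => .assign (r q) e)).exec s) ∧
      (∀ x, s.reg x = e.eval s₀ →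
        ((Prog.block (l.map fun q => .assign (r q) e)).exec s).reg x = e.eval s₀) ∧
      ∀ q ∈ l, ((Prog.block (l.map fun q => .assign (r q) e)).exec s).reg (r q) = e.eval s₀ := by
  intro l
  induction l with
  | nil => intro s hs; exact ⟨trivial, hs, fun x hx => hx, by simp⟩
  | cons p l ih =>
    intro s hs
    obtain ⟨hev, hfit⟩ := he s hs
    obtain ⟨i1, i2, i3, i4⟩ := ih (s.setReg (r p) (e.eval s)) (hs.setReg (hr p) _)
    refine ⟨⟨hfit, i1⟩, i2, fun x hx => i3 x ?_, fun q hq => ?_⟩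
    · by_cases hxp : x = r p
      · simp [State.setReg, hxp, hev]
      · simpa [State.setReg, hxp] using hx
    · rcases List.mem_cons.1 hq with rfl | hq
      · exact i3 _ (by simp [State.setReg, hev])
      · exact i4 q hq

/-- Stores leave the registers unchanged, so later operands keep their values. The alternative
"already correct or still to be written" in the last clause carries the induction. -/
theorem storeAll_spec {W : ℕ} {ι : Type*} (a : ι → ℕ) (ha : Function.Injective a) (i : Expr)
    (e : ι → Expr) {s₀ : State}
    (hi : ∀ s : State, s.reg = s₀.reg → i.eval s = i.eval s₀ ∧ i.Fits W s)
    (he : ∀ q, ∀ s : State, s.reg = s₀.reg → (e q).eval s = (e q).eval s₀ ∧ (e q).Fits W s) :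
    ∀ (l : List ι) (s : State), s.reg = s₀.reg →
      (Prog.block (l.map fun q => .store (a q) i (e q))).Safe W s ∧
      ((Prog.block (l.map fun q => .store (a q) i (e q))).exec s).reg = s₀.reg ∧
      (∀ x, (∀ q ∈ l, a q ≠ x) →
        ((Prog.block (l.map fun q => .store (a q) i (e q))).exec s).arr x = s.arr x) ∧
      (∀ q j, j ≠ i.eval s₀ →
        ((Prog.block (l.map fun q => .store (a q) i (e q))).exec s).arr (a q) j =
          s.arr (a q) j) ∧
      (∀ q, s.arr (a q) (i.eval s₀) = (e q).eval s₀ ∨ q ∈ l →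
        ((Prog.block (l.map fun q => .store (a q) i (e q))).exec s).arr (a q) (i.eval s₀) =
          (e q).eval s₀) := by
  intro l
  induction l with
  | nil => intro s hs; exact ⟨trivial, hs, fun _ _ => rfl, fun _ _ _ => rfl, by simp [Prog.block,
      Prog.exec]⟩
  | cons p l ih =>
    intro s hs
    obtain ⟨hev, hfit⟩ := he p s hs
    obtain ⟨iev, ifit⟩ := hi s hs
    obtain ⟨i1, i2, i3, i4, i5⟩ := ih (s.setArr (a p) (i.eval s) ((e p).eval s)) hs
    refine ⟨⟨⟨ifit, hfit⟩, i1⟩, i2, fun x hx => ?_, fun q j hj => ?_, fun q hq => ?_⟩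
    · refine (i3 x fun q hq => hx q (by simp [hq])).trans ?_
      simp [State.setArr, (hx p (by simp)).symm]
    · refine (i4 q j hj).trans ?_
      by_cases hqp : a q = a p
      · simp [State.setArr, hqp, iev, hj]
      · simp [State.setArr, hqp]
    · refine i5 q ?_
      by_cases hqp : q = p
      · left; simp [State.setArr, hqp, iev, hev]
      · rcases hq with hq | hq
        · left; simpa [State.setArr, ha.ne hqp] using hq
        · exact .inr ((List.mem_cons.1 hq).resolve_left hqp)

end WordRAM

/-! ### The dynamic program -/

namespace TruncProfile

open WordRAM

variable {k : ℕ}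

/-- An enumeration of the profiles. -/
noncomputable def code (q : Profile k) : ℕ := (Finite.equivFin (Profile k) q).val

theorem code_injective : Function.Injective (code (k := k)) := fun _ _ h =>
  (Finite.equivFin (Profile k)).injective (Fin.ext h)

/-- A list of all profiles. -/
noncomputable def profiles (k : ℕ) : List (Profile k) :=
  (@Finset.univ (Profile k) (Fintype.ofFinite _)).toList

theorem mem_profiles (q : Profile k) : q ∈ profiles k := by
  simp [profiles]

/-- The array that holds the costs of the profile `q`. -/
noncomputable def costArr (q : Profile k) : ℕ := 4 + code q

theorem costArr_injective : Function.Injective (costArr (k := k)) := fun _ _ h =>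
  code_injective (by simpa [costArr] using h)

/-- The register that holds the new cost of the profile `q`. -/
noncomputable def costReg (q : Profile k) : ℕ := 5 + code q

/-- The comparisons that compute the cost table of a union of two bags. -/
noncomputable def mergeItems (k : ℕ) : List (ℕ × Expr) :=
  (profiles k ×ˢ profiles k).map fun q =>
    (costReg (merge q.1 q.2),
      -- The order matters: the root of the union is the neighbour in register `3`, so its bag is
      -- the first argument of `merge`.
      .add (.get (costArr q.1) (.reg 3)) (.get (costArr q.2) (.reg 2)))

/-- Absorb the leaf in register `2` into its only neighbour. -/
noncomputable def mergeStep (k : ℕ) : Prog :=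
  .block [
    -- For a leaf, the sum of the remaining neighbours is the neighbour.
    .assign 3 (.get 3 (.reg 2)),
    .block ((profiles k).map fun q => .assign (costReg q) (.reg 4)),
    .block ((mergeItems k).map Prog.relax),
    .block ((profiles k).map fun q => .store (costArr q) (.reg 3) (.reg (costReg q))),
    -- Degree zero keeps the absorbed vertex from passing the leaf test again.
    .store 2 (.reg 2) (.lit 0),
    .store 2 (.reg 3) (.sub (.get 2 (.reg 3)) (.lit 1)),
    .store 3 (.reg 3) (.sub (.get 3 (.reg 3)) (.reg 2)),
    -- Only the neighbour can have become a leaf, so it is examined next; the cursor in register `1`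
    -- stays.
    .assign 2 (.reg 3)]

/-- The bound `2 * n + 2` leaves room for the sum of two costs, each at most `n + 1`. -/
theorem mergeStep_spec {W n v p : ℕ} {s : State} (hW : 2 * n + 2 ≤ W) (hv : v < n) (hp : p < n)
    (h2 : s.reg 2 = v) (h3 : s.arr 3 v = p) (h4 : s.reg 4 = n + 1)
    (hcv : ∀ q : Profile k, s.arr (costArr q) v ≤ n + 1)
    (hcp : ∀ q : Profile k, s.arr (costArr q) p ≤ n + 1)
    (hvp : v ≠ p) (hdp : s.arr 2 p ≤ W) (hsp : s.arr 3 p ≤ W) :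
    (mergeStep k).Safe W s ∧
    (∀ r, r = 0 ∨ r = 1 ∨ r = 4 → ((mergeStep k).exec s).reg r = s.reg r) ∧
    ((mergeStep k).exec s).reg 2 = p ∧ ((mergeStep k).exec s).reg 3 = p ∧
    (∀ x, ((mergeStep k).exec s).arr 2 x =
      if x = p then s.arr 2 p - 1 else if x = v then 0 else s.arr 2 x) ∧
    (∀ x, ((mergeStep k).exec s).arr 3 x = if x = p then s.arr 3 p - v else s.arr 3 x) ∧
    (∀ (q : Profile k) (j : ℕ), j ≠ p →
      ((mergeStep k).exec s).arr (costArr q) j = s.arr (costArr q) j) ∧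
    ∀ q : Profile k, ((mergeStep k).exec s).arr (costArr q) p ≤ n + 1 ∧
      ∀ c ≤ n, ((mergeStep k).exec s).arr (costArr q) p ≤ c ↔
        ∃ q₁ q₂, merge q₁ q₂ = q ∧ s.arr (costArr q₁) p + s.arr (costArr q₂) v ≤ c := by
  set s₁ := s.setReg 3 p with hs₁
  have e₁ : (Prog.assign 3 (.get 3 (.reg 2))).exec s = s₁ := by
    simp [Prog.exec, Expr.eval, h2, h3, hs₁]
  have r1 : ∀ r, r ≠ 3 → s₁.reg r = s.reg r := fun r hr => by simp [hs₁, State.setReg, hr]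
  have r13 : s₁.reg 3 = p := by simp [hs₁, State.setReg]
  have a1 : s₁.arr = s.arr := rfl
  obtain ⟨f1, ag1, -, v1⟩ := assignAll_spec (N := 5) (W := W) (costReg (k := k)) (.reg 4) (s₀ := s₁)
    (fun t ht => ⟨ht.2 4 (by omega), by
      simp only [Expr.Fits, ht.2 4 (by omega), r1 4 (by omega), h4]; omega⟩)
    (fun q => by simp [costReg]) (profiles k) s₁ ⟨rfl, fun _ _ => rfl⟩
  set s₂ := (Prog.block ((profiles k).map fun q => .assign (costReg q) (.reg 4))).exec s₁ with hs₂
  have v1' : ∀ q : Profile k, s₂.reg (costReg q) = n + 1 := fun q => by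
    rw [v1 q (mem_profiles q)]; simp [Expr.eval, r1 4, h4]
  obtain ⟨f2, ag2, v2⟩ := relaxAll_spec (N := 5) (W := W) (s₀ := s₁) (mergeItems k)
    (by
      intro x hx
      obtain ⟨q, -, rfl⟩ := List.mem_map.1 hx
      refine ⟨by simp [costReg], fun t ht => ?_⟩
      have b2 := ht.2 2 (by omega)
      have b3 := ht.2 3 (by omega)
      have c1 := hcp q.1
      have c2 := hcv q.2
      simp only [Expr.eval, Expr.Fits, ht.1, b2, b3, r13, r1 2 (by omega), h2, a1]
      refine ⟨trivial, ⟨by omega, by omega⟩, ⟨by omega, by omega⟩, by omega⟩)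
    s₂ ag1 (by
      intro x hx
      obtain ⟨q, -, rfl⟩ := List.mem_map.1 hx
      rw [v1']; omega)
  set s₃ := (Prog.block ((mergeItems k).map Prog.relax)).exec s₂ with hs₃
  have v2' : ∀ q : Profile k, s₃.reg (costReg q) ≤ n + 1 ∧
      ∀ c ≤ n, s₃.reg (costReg q) ≤ c ↔
        ∃ q₁ q₂, merge q₁ q₂ = q ∧ s.arr (costArr q₁) p + s.arr (costArr q₂) v ≤ c := by
    intro q
    refine ⟨(v2 _ _).2 (.inl (v1' q).le), fun c hc => (v2 _ _).trans ?_⟩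
    rw [v1' q]
    constructor
    · rintro (h | ⟨e, he, hec⟩)
      · omega
      · obtain ⟨⟨q₁, q₂⟩, -, hq⟩ := List.mem_map.1 he
        obtain ⟨hq, rfl⟩ := Prod.ext_iff.1 hq
        refine ⟨q₁, q₂, code_injective (by simpa [costReg] using hq), ?_⟩
        simpa [Expr.eval, r13, r1 2, h2, a1] using hec
    · rintro ⟨q₁, q₂, rfl, h⟩
      refine .inr ⟨_, List.mem_map.2 ⟨(q₁, q₂), List.mem_product.2 ⟨mem_profiles _,
        mem_profiles _⟩, rfl⟩, ?_⟩
      simpa [Expr.eval, r13, r1 2, h2, a1] using h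
  have r33 : s₃.reg 3 = p := by rw [ag2.2 3 (by omega), r13]
  obtain ⟨f3, g3, o3, j3, v3⟩ := storeAll_spec (W := W) (costArr (k := k)) costArr_injective (.reg 3)
    (fun q => .reg (costReg q)) (s₀ := s₃)
    (fun t ht => by simp only [Expr.eval, Expr.Fits, ht, r33]; exact ⟨trivial, by omega⟩)
    (fun q t ht => by
      have := (v2' q).1
      simp only [Expr.eval, Expr.Fits, ht]; exact ⟨trivial, by omega⟩) (profiles k) s₃ rfl
  set s₄ := (Prog.block ((profiles k).map fun q =>
    .store (costArr q) (.reg 3) (.reg (costReg q)))).exec s₃ with hs₄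
  have R : ∀ r < 5, r ≠ 3 → s₄.reg r = s.reg r := fun r hr hr3 => by
    rw [g3, ag2.2 r hr, r1 r hr3]
  have R3 : s₄.reg 3 = p := by rw [g3, r33]
  have A : ∀ x < 4, s₄.arr x = s.arr x := fun x hx => by
    rw [o3 x (fun q _ => by simp only [costArr]; omega), ag2.1, a1]
  have AC : ∀ (q : Profile k) (j : ℕ), j ≠ p → s₄.arr (costArr q) j = s.arr (costArr q) j := by
    intro q j hj
    rw [j3 q j (by simpa [Expr.eval, r33] using hj), ag2.1, a1]
  have AP : ∀ q : Profile k, s₄.arr (costArr q) p = s₃.reg (costReg q) := by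
    intro q
    have := v3 q (.inr (mem_profiles q))
    simpa only [Expr.eval, r33] using this
  have ne2 : ∀ q : Profile k, costArr q ≠ 2 := fun q => by simp only [costArr]; omega
  have ne3 : ∀ q : Profile k, costArr q ≠ 3 := fun q => by simp only [costArr]; omega
  have e : (mergeStep k).exec s = (Prog.block [
    .store 2 (.reg 2) (.lit 0),
    .store 2 (.reg 3) (.sub (.get 2 (.reg 3)) (.lit 1)),
    .store 3 (.reg 3) (.sub (.get 3 (.reg 3)) (.reg 2)),
    .assign 2 (.reg 3)]).exec s₄ := by
    rw [hs₄, hs₃, hs₂, ← e₁]; rfl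
  refine ⟨?_, ?_, ?_, ?_, ?_, ?_, ?_, ?_⟩
  · refine ⟨?_, ?_⟩
    · simp only [Prog.Safe, Expr.Fits, Expr.eval, h2, h3]; omega
    · rw [e₁]
      refine ⟨f1, f2, f3, ?_⟩
      simp only [Prog.block, Prog.Safe, Expr.Fits, Prog.exec, Expr.eval, State.setArr, ← hs₄,
        ← hs₃, ← hs₂, R 2 (by omega) (by omega), R3, h2, A 2 (by omega)]
      simp [hvp.symm, A 3]
      omega
  · intro r hr
    rw [e, ← R r (by omega) (by omega)]
    have : r ≠ 2 := by omega
    simp [Prog.block, Prog.exec, Expr.eval, State.setArr, State.setReg, this]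
  · rw [e]; simp [Prog.block, Prog.exec, Expr.eval, State.setArr, State.setReg, R3]
  · rw [e]; simp [Prog.block, Prog.exec, Expr.eval, State.setArr, State.setReg, R3]
  · intro x
    rw [e]
    simp [Prog.block, Prog.exec, Expr.eval, State.setArr, State.setReg, R3, R 2, h2, A 2,
      Function.update_apply, hvp.symm]
  · intro x
    rw [e]
    simp [Prog.block, Prog.exec, Expr.eval, State.setArr, State.setReg, R3, R 2, h2, A 3,
      Function.update_apply]
  · intro q j hj
    rw [e, ← AC q j hj]
    simp [Prog.block, Prog.exec, Expr.eval, State.setArr, State.setReg, ne2 q, ne3 q]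
  · intro q
    have : ((mergeStep k).exec s).arr (costArr q) p = s₃.reg (costReg q) := by
      rw [e, ← AP q]
      simp [Prog.block, Prog.exec, Expr.eval, State.setArr, State.setReg, ne2 q, ne3 q]
    rw [this]
    exact v2' q

/-- Record the edge with the index in register `1` in the degrees (array `2`) and in the sums of
the neighbours (array `3`). -/
def edgeStep : Prog :=
  .block [
    .store 2 (.get 0 (.reg 1)) (.add (.get 2 (.get 0 (.reg 1))) (.lit 1)),
    .store 2 (.get 1 (.reg 1)) (.add (.get 2 (.get 1 (.reg 1))) (.lit 1)),
    .store 3 (.get 0 (.reg 1)) (.add (.get 3 (.get 0 (.reg 1))) (.get 1 (.reg 1))),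
    .store 3 (.get 1 (.reg 1)) (.add (.get 3 (.get 1 (.reg 1))) (.get 0 (.reg 1))),
    .assign 1 (.add (.reg 1) (.lit 1))]

theorem edgeStep_spec {W j a b M : ℕ} {s : State} (hj : s.reg 1 = j) (ha : s.arr 0 j = a)
    (hb : s.arr 1 j = b) (haM : a ≤ M) (hbM : b ≤ M) (hjM : j + 1 ≤ W) (hW : 2 * M + 2 ≤ W)
    (h2 : ∀ x, s.arr 2 x + 2 ≤ W) (h3 : ∀ x, s.arr 3 x + 2 * M ≤ W) :
    edgeStep.Safe W s ∧ (∀ r, r ≠ 1 → (edgeStep.exec s).reg r = s.reg r) ∧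
    (edgeStep.exec s).reg 1 = j + 1 ∧
    (∀ x < 2, (edgeStep.exec s).arr x = s.arr x) ∧
    (∀ x, (edgeStep.exec s).arr 2 x =
      s.arr 2 x + ((if a = x then 1 else 0) + (if b = x then 1 else 0))) ∧
    (∀ x, (edgeStep.exec s).arr 3 x =
      s.arr 3 x + ((if a = x then b else 0) + (if b = x then a else 0))) := by
  refine ⟨?_, ?_, ?_, ?_, ?_, ?_⟩
  · have h2a := h2 a
    have h2b := h2 b
    have h3a := h3 a
    have h3b := h3 b
    simp [edgeStep, Prog.block, Prog.Safe, Prog.exec, Expr.eval, Expr.Fits, State.setArr, hj, ha,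
      hb, Function.update_apply]
    split_ifs with h
    · subst h
      omega
    · omega
  · intro r hr
    simp [edgeStep, Prog.block, Prog.exec, State.setArr, State.setReg, hr]
  · simp [edgeStep, Prog.block, Prog.exec, State.setArr, State.setReg, Expr.eval, hj]
  · intro x hx
    have h2 : x ≠ 2 := by omega
    have h3 : x ≠ 3 := by omega
    simp [edgeStep, Prog.block, Prog.exec, State.setArr, State.setReg, h2, h3]
  · intro x
    simp [edgeStep, Prog.block, Prog.exec, State.setArr, State.setReg, Expr.eval, hj, ha, hb,
      Function.update_apply, eq_comm (a := x)]
    split_ifs <;> simp_all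
  · intro x
    simp [edgeStep, Prog.block, Prog.exec, State.setArr, State.setReg, Expr.eval, hj, ha, hb,
      Function.update_apply, eq_comm (a := x)]
    split_ifs <;> simp_all [add_assoc]

open Classical in
/-- The initial cost of the profile `q`. -/
noncomputable def leafExpr (q : Profile k) : Expr :=
  if q = leafOut k then .lit 0 else if q = leafIn k then .lit 1 else .reg 4

/-- Initialize the cost table of the vertex in register `1`. -/
noncomputable def initStep (k : ℕ) : Prog :=
  .seq (.block ((profiles k).map fun q => .store (costArr q) (.reg 1) (leafExpr q)))
    (.assign 1 (.add (.reg 1) (.lit 1)))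

theorem initStep_spec {W n v : ℕ} {s : State} (hW : n + 1 ≤ W) (hv : v < n) (h1 : s.reg 1 = v)
    (h4 : s.reg 4 = n + 1) :
    (initStep k).Safe W s ∧ (∀ r, r ≠ 1 → ((initStep k).exec s).reg r = s.reg r) ∧
    ((initStep k).exec s).reg 1 = v + 1 ∧
    (∀ x < 4, ((initStep k).exec s).arr x = s.arr x) ∧
    (∀ (q : Profile k) (j : ℕ), j ≠ v →
      ((initStep k).exec s).arr (costArr q) j = s.arr (costArr q) j) ∧
    ∀ q : Profile k, ((initStep k).exec s).arr (costArr q) v = leafCost k n q := by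
  obtain ⟨f, g, o, j, w⟩ := storeAll_spec (W := W) (costArr (k := k)) costArr_injective (.reg 1)
    leafExpr (s₀ := s)
    (fun t ht => by simp only [Expr.eval, Expr.Fits, ht, h1]; exact ⟨trivial, by omega⟩)
    (fun q t ht => by
      unfold leafExpr
      split_ifs <;> simp only [Expr.eval, Expr.Fits, ht, h4] <;> exact ⟨trivial, by omega⟩)
    (profiles k) s rfl
  have ev : ∀ q : Profile k, (leafExpr q).eval s = leafCost k n q := fun q => by
    unfold leafExpr leafCost
    split_ifs <;> simp [Expr.eval, h4]
  refine ⟨⟨f, ?_⟩, fun r hr => ?_, ?_, fun x hx => ?_, fun q x hx => ?_, fun q => ?_⟩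
  · simp only [Prog.Safe, Expr.Fits, Expr.eval, g, h1]
    omega
  · simp [initStep, Prog.exec, State.setReg, hr, g]
  · simp [initStep, Prog.exec, State.setReg, Expr.eval, g, h1]
  · exact o x fun q _ => by simp only [costArr]; omega
  · exact j q x (by simpa [Expr.eval, h1] using hx)
  · have := w q (.inr (mem_profiles q))
    rw [ev] at this
    simp only [Expr.eval, h1] at this
    exact this

/-- Move on to the next vertex. -/
def nextStep : Prog := .seq (.assign 1 (.add (.reg 1) (.lit 1))) (.assign 2 (.reg 1))

/-- Test whether the vertex in register `2` has degree one. -/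
def leafTest : Expr :=
  -- With degree `d`, this is `1 - |d - 1|`; the absolute value is a sum of two truncated
  -- differences, one of which vanishes.
  .sub (.lit 1) (.add (.sub (.get 2 (.reg 2)) (.lit 1)) (.sub (.lit 1) (.get 2 (.reg 2))))

/-- Absorb the vertex in register `2` if it is a leaf, otherwise move on. -/
noncomputable def mainStep (k : ℕ) : Prog := .cond leafTest (mergeStep k) nextStep

open Classical in
/-- The comparisons that compute the least cost of an accepted profile. -/
noncomputable def finalItems (acc : Profile k → Prop) : List (ℕ × Expr) :=
  ((profiles k).filter fun q => acc q).map fun q => (5, .get (costArr q) (.reg 3))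

/-- Put the least cost of an accepted profile of the root into register `0`. -/
noncomputable def finalStep (acc : Profile k → Prop) : Prog :=
  .block [.assign 5 (.reg 4), .block ((finalItems acc).map Prog.relax), .assign 0 (.reg 5)]

theorem finalStep_spec {acc : Profile k → Prop} {W n r : ℕ} {s : State} (hW : n + 1 ≤ W)
    (hr : r < n) (h3 : s.reg 3 = r) (h4 : s.reg 4 = n + 1)
    (hc : ∀ q : Profile k, s.arr (costArr q) r ≤ n + 1) :
    (finalStep acc).Safe W s ∧ ∀ c ≤ n, ((finalStep acc).exec s).reg 0 ≤ c ↔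
      ∃ q, acc q ∧ s.arr (costArr q) r ≤ c := by
  set s₁ := s.setReg 5 (n + 1) with hs₁
  have e₁ : (Prog.assign 5 (.reg 4)).exec s = s₁ := by
    simp [Prog.exec, Expr.eval, h4, hs₁]
  have r13 : s₁.reg 3 = r := by simp [hs₁, State.setReg, h3]
  have r15 : s₁.reg 5 = n + 1 := by simp [hs₁, State.setReg]
  have a1 : s₁.arr = s.arr := rfl
  obtain ⟨f, ag, w⟩ := relaxAll_spec (N := 5) (W := W) (s₀ := s₁) (finalItems acc)
    (by
      intro x hx
      obtain ⟨q, -, rfl⟩ := List.mem_map.1 hx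
      refine ⟨le_rfl, fun t ht => ?_⟩
      have := hc q
      simp only [Expr.eval, Expr.Fits, ht.1, ht.2 3 (by omega), r13, a1]
      exact ⟨trivial, by omega, by omega⟩)
    s₁ ⟨rfl, fun _ _ => rfl⟩ (by
      intro x hx
      obtain ⟨q, -, rfl⟩ := List.mem_map.1 hx
      simp only [r15]; omega)
  refine ⟨⟨?_, ?_⟩, fun c hc => ?_⟩
  · simp only [Prog.Safe, Expr.Fits, h4]; omega
  · rw [e₁]
    have := (w 5 (n + 1)).2 (.inl r15.le)
    refine ⟨f, ?_, trivial⟩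
    simp only [Prog.Safe, Expr.Fits]; omega
  · have e : ((finalStep acc).exec s).reg 0 =
        ((Prog.block ((finalItems acc).map Prog.relax)).exec s₁).reg 5 := by
      rw [← e₁]
      simp [finalStep, Prog.block, Prog.exec, State.setReg, Expr.eval]
    rw [e, w]
    constructor
    · rintro (h | ⟨x, hx, h⟩)
      · omega
      · obtain ⟨q, hq, he⟩ := List.mem_map.1 hx
        obtain ⟨-, rfl⟩ := Prod.ext_iff.1 he
        refine ⟨q, by simpa using (List.mem_filter.1 hq).2, ?_⟩
        simpa [Expr.eval, r13, a1] using h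
    · rintro ⟨q, hq, h⟩
      refine .inr ⟨_, List.mem_map.2 ⟨q, List.mem_filter.2 ⟨mem_profiles q, by simpa using hq⟩,
        rfl⟩, ?_⟩
      simpa [Expr.eval, r13, a1] using h

end TruncProfile

namespace TruncProfile

open WordRAM

variable {k : ℕ}

/-! ### Degrees and sums of neighbours -/

/-- The sum of `h` over the other endpoints of the edges in `l` at `x`. -/
def edgeSum {n : ℕ} (h : Fin n → ℕ) (l : List (Fin n × Fin n)) (x : ℕ) : ℕ :=
  (l.map fun p => (if (p.1 : ℕ) = x then h p.2 else 0) + (if (p.2 : ℕ) = x then h p.1 else 0)).sum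

theorem edgeSum_le {n M : ℕ} {h : Fin n → ℕ} (hM : ∀ v, h v ≤ M) (x : ℕ) :
    ∀ l : List (Fin n × Fin n), edgeSum h l x ≤ 2 * M * l.length
  | [] => by simp [edgeSum]
  | p :: l => by
    have ih := edgeSum_le hM x l
    have h1 := hM p.1
    have h2 := hM p.2
    simp only [edgeSum, List.map_cons, List.sum_cons, List.length_cons] at ih ⊢
    rw [Nat.mul_add]
    split_ifs <;> omega

theorem edgeSum_take_succ {n : ℕ} (h : Fin n → ℕ) (l : List (Fin n × Fin n)) (x : ℕ) {j : ℕ}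
    (hj : j < l.length) : edgeSum h (l.take (j + 1)) x = edgeSum h (l.take j) x +
      ((if ((l[j]).1 : ℕ) = x then h (l[j]).2 else 0) +
        (if ((l[j]).2 : ℕ) = x then h (l[j]).1 else 0)) := by
  rw [List.take_add_one, List.getElem?_eq_getElem hj]
  simp only [edgeSum, List.map_append, List.sum_append, Option.toList_some, List.map_cons,
    List.map_nil, List.sum_cons, List.sum_nil, Nat.add_zero]

/-- Listing each edge in both orientations enumerates the darts once each. The weight `1` yields
degrees, the weight `v` yields sums of neighbours. -/
theorem edgeSum_eq {n : ℕ} {T : SimpleGraph (Fin n)} [DecidableRel T.Adj]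
    {L : List (Fin n × Fin n)} (hL : T.IsEdgeList L) (h : Fin n → ℕ) (v : Fin n) :
    edgeSum h L v = ∑ w ∈ T.nbrsIn Finset.univ v, h w := by
  have hmem : ∀ a b, (a, b) ∈ L ++ L.map Prod.swap ↔ T.Adj a b := by
    intro a b
    rw [← SimpleGraph.mem_edgeSet, ← hL.2]
    simp only [List.mem_append, List.mem_map, Prod.exists, Sym2.eq_iff, Prod.swap_prod_mk,
      Prod.mk.injEq]
    constructor
    · rintro (h | ⟨x, y, h, rfl, rfl⟩)
      · exact ⟨a, b, h, .inl ⟨rfl, rfl⟩⟩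
      · exact ⟨x, y, h, .inr ⟨rfl, rfl⟩⟩
    · rintro ⟨x, y, h, ⟨rfl, rfl⟩ | ⟨rfl, rfl⟩⟩
      · exact .inl h
      · exact .inr ⟨_, _, h, rfl, rfl⟩
  -- A dart occurring in both halves would come from one unordered edge and be its own reversal,
  -- that is, a loop.
  have hnd : (L ++ L.map Prod.swap).Nodup := by
    have h1 := hL.1.of_map
    refine List.Nodup.append h1 (h1.map Prod.swap_injective) ?_
    rintro ⟨a, b⟩ hp hq
    obtain ⟨⟨x, y⟩, hxyL, he⟩ := List.mem_map.1 hq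
    obtain ⟨rfl, rfl⟩ := Prod.ext_iff.1 he
    have hxy : s(y, x) = s(x, y) := Sym2.eq_swap
    have := List.inj_on_of_nodup_map hL.1 hp hxyL hxy
    have hloop := (hmem _ _).1 (List.mem_append_left _ hp)
    exact hloop.ne (Prod.ext_iff.1 this).1
  have e : ∀ l : List (Fin n × Fin n), edgeSum h l v =
      ((l ++ l.map Prod.swap).map fun p => if p.1 = v then h p.2 else 0).sum := by
    intro l
    simp [edgeSum, List.sum_map_add, Fin.ext_iff, Function.comp_def]
  rw [e, ← List.sum_toFinset _ hnd, ← Finset.sum_filter]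
  refine Finset.sum_bij' (fun p _ => p.2) (fun w _ => (v, w)) ?_ ?_ ?_ ?_ ?_
  · rintro ⟨a, b⟩ hp
    obtain ⟨hp', rfl⟩ := Finset.mem_filter.1 hp
    exact SimpleGraph.mem_nbrsIn.2 ⟨Finset.mem_univ _, (hmem _ _).1 (List.mem_toFinset.1 hp')⟩
  · intro w hw
    exact Finset.mem_filter.2 ⟨List.mem_toFinset.2 ((hmem _ _).2 (SimpleGraph.mem_nbrsIn.1 hw).2),
      rfl⟩
  · rintro ⟨a, b⟩ hp
    obtain ⟨hp, rfl⟩ := Finset.mem_filter.1 hp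
    rfl
  · intros; rfl
  · intros; rfl

theorem length_edgeList {n : ℕ} {T : SimpleGraph (Fin n)} (hT : T.IsTree)
    {L : List (Fin n × Fin n)} (hL : T.IsEdgeList L) : L.length + 1 = n := by
  classical
  have h1 := hT.card_edgeFinset
  have h2 : (L.map fun p => s(p.1, p.2)).toFinset = T.edgeFinset := by
    ext e; rw [List.mem_toFinset, hL.2, SimpleGraph.mem_edgeFinset]
  rw [← h2, List.toFinset_card_of_nodup hL.1, List.length_map, Fintype.card_fin] at h1
  exact h1

/-! ### The three loops -/

section Loops

variable {n W : ℕ} {T : SimpleGraph (Fin n)} [DecidableRel T.Adj] {L : List (Fin n × Fin n)}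

/-- The invariant of the loop that reads the edges. -/
structure EdgeInv (L : List (Fin n × Fin n)) (m : ℕ) (s : State) : Prop where
  reg0 : s.reg 0 = n
  reg1 : s.reg 1 + m = L.length
  reg2 : s.reg 2 = 0
  reg3 : s.reg 3 = 0
  reg4 : s.reg 4 = n + 1
  arr01 : ∀ x < 2, s.arr x = (inputState L).arr x
  deg : ∀ x, s.arr 2 x = edgeSum (fun _ => 1) (L.take (s.reg 1)) x
  sum : ∀ x, s.arr 3 x = edgeSum (fun v => (v : ℕ)) (L.take (s.reg 1)) x

theorem EdgeInv.step (hn : 1 ≤ n) (hW : 4 * n ^ 2 ≤ W) (hL : L.length + 1 = n) {m : ℕ} {s : State}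
    (h : EdgeInv L (m + 1) s) : edgeStep.Safe W s ∧ EdgeInv L m (edgeStep.exec s) := by
  have hj : s.reg 1 < L.length := by have := h.reg1; omega
  have ha : s.arr 0 (s.reg 1) = (L[s.reg 1]).1 := by
    rw [h.arr01 0 (by omega)]; simp [inputState, hj]
  have hb : s.arr 1 (s.reg 1) = (L[s.reg 1]).2 := by
    rw [h.arr01 1 (by omega)]; simp [inputState, hj]
  have hlen : (L.take (s.reg 1)).length ≤ n - 1 := by rw [List.length_take]; omega
  have hsq : n ≤ n ^ 2 := Nat.le_self_pow (by omega) n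
  obtain ⟨f, r, r1, a, d, e⟩ := edgeStep_spec (W := W) (M := n) rfl ha hb (L[s.reg 1]).1.2.le
    (L[s.reg 1]).2.2.le (by omega) (by omega)
    (fun x => by
      rw [h.deg]
      have := edgeSum_le (M := 1) (h := fun _ : Fin n => 1) (fun _ => le_rfl) x (L.take (s.reg 1))
      omega)
    (fun x => by
      rw [h.sum]
      have := edgeSum_le (M := n) (h := fun v : Fin n => (v : ℕ)) (fun v => v.2.le) x
        (L.take (s.reg 1))
      -- At most `n - 1` edges have been read, each contributing at most `2 * n`; this is where a
      -- quadratic word bound is needed.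
      have h2 := Nat.mul_le_mul_left (2 * n) (show (L.take (s.reg 1)).length + 1 ≤ n by omega)
      have h3 : 2 * n * n = 2 * n ^ 2 := by ring
      rw [Nat.mul_add] at h2
      omega)
  refine ⟨f, ⟨?_, ?_, ?_, ?_, ?_, ?_, ?_, ?_⟩⟩
  · rw [r 0 (by omega), h.reg0]
  · rw [r1, ← h.reg1]; omega
  · rw [r 2 (by omega), h.reg2]
  · rw [r 3 (by omega), h.reg3]
  · rw [r 4 (by omega), h.reg4]
  · intro x hx; rw [a x hx, h.arr01 x hx]
  · intro x; rw [d, r1, edgeSum_take_succ _ _ _ hj, h.deg]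
  · intro x; rw [e, r1, edgeSum_take_succ _ _ _ hj, h.sum]

/-- The invariant of the loop that initializes the cost tables. -/
structure InitInv (T : SimpleGraph (Fin n)) [DecidableRel T.Adj] (k m : ℕ) (s : State) :
    Prop where
  reg0 : s.reg 0 = n
  reg1 : s.reg 1 + m = n
  reg2 : s.reg 2 = 0
  reg3 : s.reg 3 = 0
  reg4 : s.reg 4 = n + 1
  deg : ∀ v : Fin n, s.arr 2 v = (T.nbrsIn Finset.univ v).card
  sum : ∀ v : Fin n, s.arr 3 v = ∑ w ∈ T.nbrsIn Finset.univ v, (w : ℕ)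
  cost : ∀ v < s.reg 1, ∀ q : Profile k, s.arr (costArr q) v = leafCost k n q

theorem InitInv.step (hW : n + 1 ≤ W) {m : ℕ} {s : State} (h : InitInv T k (m + 1) s) :
    (initStep k).Safe W s ∧ InitInv T k m ((initStep k).exec s) := by
  have hv : s.reg 1 < n := by have := h.reg1; omega
  obtain ⟨f, r, r1, a, j, w⟩ := initStep_spec (k := k) hW hv rfl h.reg4
  refine ⟨f, ⟨?_, ?_, ?_, ?_, ?_, ?_, ?_, ?_⟩⟩
  · rw [r 0 (by omega), h.reg0]
  · rw [r1, ← h.reg1]; omega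
  · rw [r 2 (by omega), h.reg2]
  · rw [r 3 (by omega), h.reg3]
  · rw [r 4 (by omega), h.reg4]
  · intro v; rw [a 2 (by omega), h.deg]
  · intro v; rw [a 3 (by omega), h.sum]
  · intro v hv q
    rw [r1] at hv
    by_cases hv1 : v = s.reg 1
    · rw [hv1, w]
    · rw [j q v hv1, h.cost v (by omega)]

/-- The invariant of the main loop. -/
structure MainInv (T : SimpleGraph (Fin n)) [DecidableRel T.Adj] (k m : ℕ) (s : State)
    (A : Finset (Fin n)) (b : Fin n → Fin n) : Prop where
  pruning : T.Pruning A b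
  -- The potential `m` is the number of cursor moves left plus the number of remaining vertices;
  -- each iteration lowers one of them.
  measure : s.reg 1 + m = n + A.card
  reg0 : s.reg 0 = n
  reg12 : (s.reg 1 < n ∧ s.reg 2 < n) ∨ (s.reg 1 = n ∧ s.reg 2 = n)
  reg3 : ∃ r ∈ A, s.reg 3 = (r : ℕ)
  reg4 : s.reg 4 = n + 1
  deg : ∀ v : Fin n, s.arr 2 v = if v ∈ A then (T.nbrsIn A v).card else 0
  sum : ∀ v ∈ A, s.arr 3 v = ∑ w ∈ T.nbrsIn A v, (w : ℕ)
  -- No vertex up to the cursor is a leaf, except possibly the one under examination.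
  done : ∀ v ∈ A, (v : ℕ) ≤ s.reg 1 → (v : ℕ) ≠ s.reg 2 → (T.nbrsIn A v).card ≠ 1
  cost : ∀ v ∈ A, IsCostTable T.dist k n (SimpleGraph.bag b v) v fun q => s.arr (costArr q) v

theorem InitInv.main (hT : T.IsTree) (hn : 1 ≤ n) {s s' : State} (h : InitInv T k 0 s)
    (harr : s'.arr = s.arr) (hreg : ∀ r, r ≠ 1 → s'.reg r = s.reg r) (h1 : s'.reg 1 = 0) :
    MainInv T k (2 * n) s' Finset.univ id where
  pruning := SimpleGraph.pruning_id hT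
  measure := by simp [h1]; omega
  reg0 := by rw [hreg 0 (by omega), h.reg0]
  reg12 := by rw [h1, hreg 2 (by omega), h.reg2]; omega
  reg3 := ⟨⟨0, hn⟩, Finset.mem_univ _, by rw [hreg 3 (by omega), h.reg3]⟩
  reg4 := by rw [hreg 4 (by omega), h.reg4]
  deg v := by simp [harr, h.deg]
  sum v _ := by rw [harr, h.sum]
  done v _ h2 h3 := by
    rw [h1] at h2
    rw [hreg 2 (by omega), h.reg2] at h3
    omega
  cost v _ := by
    have e : SimpleGraph.bag id v = {v} := by ext x; simp [SimpleGraph.mem_bag]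
    have e2 : (fun q => s'.arr (costArr q) v) = leafCost k n := funext fun q => by
      rw [harr]
      exact h.cost v (by have := h.reg1; omega) q
    rw [e, e2]
    exact isCostTable_singleton hn SimpleGraph.dist_self

theorem MainInv.next (hW : 2 * n ≤ W) {m : ℕ} {s : State} {A : Finset (Fin n)}
    {b : Fin n → Fin n} (h : MainInv T k m s A b) (h1 : s.reg 1 < n) (h2 : s.arr 2 (s.reg 2) ≠ 1) :
    nextStep.Safe W s ∧ ∃ m' < m, MainInv T k m' (nextStep.exec s) A b := by
  have r : ∀ r, r ≠ 1 → r ≠ 2 → (nextStep.exec s).reg r = s.reg r := fun r h1 h2 => by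
    simp [nextStep, Prog.exec, State.setReg, h1, h2]
  have r1 : (nextStep.exec s).reg 1 = s.reg 1 + 1 := by
    simp [nextStep, Prog.exec, State.setReg, Expr.eval]
  have r2 : (nextStep.exec s).reg 2 = s.reg 1 + 1 := by
    simp [nextStep, Prog.exec, State.setReg, Expr.eval]
  have a : (nextStep.exec s).arr = s.arr := rfl
  have hm := h.measure
  refine ⟨?_, m - 1, by omega, ⟨h.pruning, ?_, ?_, ?_, ?_, ?_, h.deg, h.sum, ?_, h.cost⟩⟩
  · simp [nextStep, Prog.Safe, Prog.exec, State.setReg, Expr.Fits, Expr.eval]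
    omega
  · rw [r1]; omega
  · rw [r 0 (by omega) (by omega), h.reg0]
  · rw [r1, r2]; omega
  · rw [r 3 (by omega) (by omega)]; exact h.reg3
  · rw [r 4 (by omega) (by omega), h.reg4]
  · intro v hv hv1 hv2
    rw [r1] at hv1
    rw [r2] at hv2
    by_cases hv3 : (v : ℕ) = s.reg 2
    · have := h.deg v
      rw [if_pos hv] at this
      rwa [← this, hv3]
    · exact h.done v hv (by omega) hv3

/-- Among the vertices that stay, only `p` changes its neighbourhood, and `p` becomes the examined
vertex, so `done` survives without moving the cursor. -/
theorem MainInv.merge (hW : 4 * n ^ 2 ≤ W) {m : ℕ} {s : State} {A : Finset (Fin n)}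
    {b : Fin n → Fin n} (h : MainInv T k m s A b) (h1 : s.reg 1 < n) (h2 : s.arr 2 (s.reg 2) = 1) :
    (mergeStep k).Safe W s ∧ ∃ m' < m, ∃ A' b', MainInv T k m' ((mergeStep k).exec s) A' b' := by
  obtain ⟨v, hv⟩ : ∃ v : Fin n, s.reg 2 = v := ⟨⟨s.reg 2, by have := h.reg12; omega⟩, rfl⟩
  have hn := v.2
  have hsq : n ≤ n ^ 2 := Nat.le_self_pow (by omega) n
  rw [hv, h.deg v] at h2
  have hvA : v ∈ A := by by_contra hc; simp [hc] at h2
  rw [if_pos hvA] at h2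
  obtain ⟨p, hp⟩ := Finset.card_eq_one.1 h2
  obtain ⟨hpA, hadj⟩ := SimpleGraph.mem_nbrsIn.1
    (hp ▸ Finset.mem_singleton_self p : p ∈ T.nbrsIn A v)
  have hvp : v ≠ p := hadj.ne
  have h3 : s.arr 3 v = p := by rw [h.sum v hvA, hp, Finset.sum_singleton]
  have hpA' : p ∈ A.erase v := Finset.mem_erase.2 ⟨hvp.symm, hpA⟩
  have hcard : ∀ w, (T.nbrsIn A w).card ≤ n := fun w => by
    simpa using Finset.card_le_univ (T.nbrsIn A w)
  have hvN : v ∈ T.nbrsIn A p := SimpleGraph.mem_nbrsIn.2 ⟨hvA, hadj.symm⟩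
  have hsame : ∀ w ∈ A, w ≠ v → w ≠ p → T.nbrsIn (A.erase v) w = T.nbrsIn A w := by
    intro w hw hwv hwp
    rw [SimpleGraph.nbrsIn_erase, Finset.erase_eq_of_notMem]
    intro hvw
    have : w ∈ T.nbrsIn A v := SimpleGraph.mem_nbrsIn.2 ⟨hw, (SimpleGraph.mem_nbrsIn.1 hvw).2.symm⟩
    rw [hp, Finset.mem_singleton] at this
    exact hwp this
  obtain ⟨f, r, r2, r3, d, e, c, cp⟩ := mergeStep_spec (k := k) (W := W) (by omega) v.2 p.2 hv h3
    h.reg4 (fun q => (h.cost v hvA q).1) (fun q => (h.cost p hpA q).1)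
    (fun he => hvp (Fin.ext he))
    (by rw [h.deg p, if_pos hpA]; have := hcard p; omega)
    (by
      rw [h.sum p hpA]
      have h5 := Finset.sum_le_card_nsmul (T.nbrsIn A p) (fun w => (w : ℕ)) n fun w _ => w.2.le
      have h6 := Nat.mul_le_mul_right n (hcard p)
      rw [smul_eq_mul] at h5
      have : n * n = n ^ 2 := by ring
      omega)
  have hm := h.measure
  have hA := Finset.card_erase_add_one hvA
  have hpr := h.pruning.leaf hvA hp
  have inj : ∀ {x y : Fin n}, (x : ℕ) = y ↔ x = y := Fin.ext_iff.symm
  have hA1 : A.card ≤ n := by simpa using Finset.card_le_univ A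
  refine ⟨f, m - 1, by omega, A.erase v, _, ⟨hpr, ?_, ?_, ?_, ⟨p, hpA', r3⟩, ?_, ?_, ?_, ?_, ?_⟩⟩
  · rw [r 1 (by omega)]; omega
  · rw [r 0 (by omega), h.reg0]
  · rw [r 1 (by omega), r2]; exact .inl ⟨h1, p.2⟩
  · rw [r 4 (by omega), h.reg4]
  · intro w
    rw [d]
    simp only [inj, Finset.mem_erase]
    by_cases hwp : w = p
    · subst hwp
      rw [if_pos rfl, if_pos ⟨hvp.symm, hpA⟩, h.deg, if_pos hpA, SimpleGraph.nbrsIn_erase,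
        Finset.card_erase_of_mem hvN]
    · rw [if_neg hwp]
      by_cases hwv : w = v
      · simp [hwv]
      · rw [if_neg hwv, h.deg]
        by_cases hwA : w ∈ A
        · simp [hwA, hwv, hsame w hwA hwv hwp]
        · simp [hwA]
  · intro w hw
    obtain ⟨hwv, hwA⟩ := Finset.mem_erase.1 hw
    rw [e]
    simp only [inj]
    by_cases hwp : w = p
    · subst hwp
      rw [if_pos rfl, h.sum w hpA, SimpleGraph.nbrsIn_erase, ← Finset.add_sum_erase _ _ hvN]
      omega
    · rw [if_neg hwp, h.sum w hwA, hsame w hwA hwv hwp]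
  · intro w hw hw1 hw2
    obtain ⟨hwv, hwA⟩ := Finset.mem_erase.1 hw
    rw [r 1 (by omega)] at hw1
    rw [r2] at hw2
    rw [hsame w hwA hwv fun hc => hw2 (by rw [hc])]
    exact h.done w hwA hw1 fun hc => hwv (Fin.ext (hc.trans hv))
  · intro w hw
    obtain ⟨hwv, hwA⟩ := Finset.mem_erase.1 hw
    rw [SimpleGraph.Pruning.bag_leaf b hvp, if_neg hwv]
    by_cases hwp : w = p
    · subst hwp
      rw [if_pos rfl]
      refine (h.cost w hpA).union (h.cost v hvA) (fun _ _ => SimpleGraph.dist_comm)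
        SimpleGraph.dist_self (h.pruning.mem_bag_self hpA) (h.pruning.mem_bag_self hvA) ?_
        (h.pruning.dist_bag hadj.symm) (fun q => (cp q).1) (fun q => (cp q).2)
      rw [Finset.disjoint_left]
      intro x hx hx'
      exact hvp ((SimpleGraph.mem_bag.1 hx').symm.trans (SimpleGraph.mem_bag.1 hx))
    · rw [if_neg hwp]
      have : (fun q : Profile k => ((mergeStep k).exec s).arr (costArr q) w) =
          fun q => s.arr (costArr q) w :=
        funext fun q => c q w fun hc => hwp (Fin.ext hc)
      rw [this]
      exact h.cost w hwA

theorem MainInv.leafTest_fits (hW : n + 1 ≤ W) {m : ℕ} {s : State} {A : Finset (Fin n)}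
    {b : Fin n → Fin n} (h : MainInv T k m s A b) (h1 : s.reg 1 < n) : leafTest.Fits W s := by
  obtain ⟨v, hv⟩ : ∃ v : Fin n, s.reg 2 = v := ⟨⟨s.reg 2, by have := h.reg12; omega⟩, rfl⟩
  have hd : s.arr 2 v ≤ n := by
    rw [h.deg]
    split_ifs
    · simpa using Finset.card_le_univ (T.nbrsIn A v)
    · omega
  simp only [leafTest, Expr.Fits, Expr.eval, hv]
  omega

theorem leafTest_eval (s : State) : leafTest.eval s ≠ 0 ↔ s.arr 2 (s.reg 2) = 1 := by
  simp only [leafTest, Expr.eval]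
  omega

theorem MainInv.step (hW : 4 * n ^ 2 ≤ W) {m : ℕ} {s : State} {A : Finset (Fin n)}
    {b : Fin n → Fin n} (h : MainInv T k m s A b) (h1 : s.reg 1 < n) :
    (mainStep k).Safe W s ∧ ∃ m' < m, ∃ A' b', MainInv T k m' ((mainStep k).exec s) A' b' := by
  have hsq : n ≤ n ^ 2 := Nat.le_self_pow (by omega) n
  have hf := h.leafTest_fits (W := W) (by omega) h1
  by_cases ht : leafTest.eval s = 0
  · have h2 : s.arr 2 (s.reg 2) ≠ 1 := fun hc => (leafTest_eval s).2 hc ht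
    obtain ⟨f, m', hm', hI⟩ := h.next (W := W) (by omega) h1 h2
    refine ⟨⟨hf, fun hc => absurd ht hc, fun _ => f⟩, m', hm', A, b, ?_⟩
    simpa [mainStep, Prog.exec, ht] using hI
  · obtain ⟨f, m', hm', A', b', hI⟩ := h.merge hW h1 ((leafTest_eval s).1 ht)
    refine ⟨⟨hf, fun _ => f, fun hc => absurd hc ht⟩, m', hm', A', b', ?_⟩
    simpa [mainStep, Prog.exec, ht] using hI

theorem MainInv.final {acc : Profile k → Prop} (hW : n + 1 ≤ W) {m : ℕ} {s : State}
    {A : Finset (Fin n)} {b : Fin n → Fin n} (h : MainInv T k m s A b) (h1 : n ≤ s.reg 1) :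
    (finalStep acc).Safe W s ∧ ∃ r : Fin n, ∀ c ≤ n, ((finalStep acc).exec s).reg 0 ≤ c ↔
      ∃ S : Finset (Fin n), acc (profile T.dist k Finset.univ r S) ∧ S.card ≤ c := by
  obtain ⟨r, hr, hr3⟩ := h.reg3
  have hA : A = {r} := h.pruning.eq_singleton hr fun v hv => by
    have h12 := h.reg12
    have := v.2
    -- At the end register `2` holds `n`, which is no vertex, so the exception in `done` is void.
    exact h.done v hv (by omega) (by omega)
  have hbag : SimpleGraph.bag b r = Finset.univ := by
    ext x
    have := h.pruning.owner_mem x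
    rw [hA, Finset.mem_singleton] at this
    simp [SimpleGraph.mem_bag, this]
  have hc := h.cost r hr
  rw [hbag] at hc
  obtain ⟨f, e⟩ := finalStep_spec (acc := acc) hW r.2 hr3 h.reg4 fun q => (hc q).1
  refine ⟨f, r, fun c hcn => (e c hcn).trans ?_⟩
  constructor
  · rintro ⟨q, hq, hle⟩
    obtain ⟨S, -, rfl, hS⟩ := ((hc q).2 c hcn).1 hle
    exact ⟨S, hq, hS⟩
  · rintro ⟨S, hq, hS⟩
    exact ⟨_, hq, ((hc _).2 c hcn).2 ⟨S, Finset.subset_univ S, rfl, hS⟩⟩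

end Loops

/-! ### The complete program and its running time -/

/-- The test of the loop that reads the edges. -/
def edgeTest : Expr := .sub (.sub (.reg 0) (.lit 1)) (.reg 1)

/-- The test whether register `1` has not yet reached the number of vertices. -/
def vertexTest : Expr := .sub (.reg 0) (.reg 1)

/-- The dynamic program that computes the least size of a set with an accepted profile. -/
noncomputable def program (acc : Profile k → Prop) : Prog :=
  .seq (.assign 4 (.add (.reg 0) (.lit 1))) <|
  .seq (.loop edgeTest edgeStep) <|
  .seq (.assign 1 (.lit 0)) <|
  .seq (.loop vertexTest (initStep k)) <|
  .seq (.assign 1 (.lit 0)) <|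
  .seq (.loop vertexTest (mainStep k)) (finalStep acc)

/-- A bound on the number of steps of the program per vertex. -/
noncomputable def stepBound (acc : Profile k → Prop) : ℕ :=
  (edgeTest.cost + 1 + edgeStep.bound) + 2 * (vertexTest.cost + 1 + (initStep k).bound) +
    3 * (vertexTest.cost + 1 + (mainStep k).bound) + (finalStep acc).bound + 8

theorem program_spec (acc : Profile k → Prop) {n W : ℕ} {T : SimpleGraph (Fin n)} (hT : T.IsTree)
    {L : List (Fin n × Fin n)} (hL : T.IsEdgeList L) (hW : 4 * n ^ 2 ≤ W) :
    ∃ t ≤ stepBound acc * n, ∃ s, Run W (program acc) (inputState L) t s ∧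
      ∃ r : Fin n, ∀ c ≤ n, s.reg 0 ≤ c ↔
        ∃ S : Finset (Fin n), acc (profile T.dist k Finset.univ r S) ∧ S.card ≤ c := by
  classical
  have hlen := length_edgeList hT hL
  have hn : 1 ≤ n := by omega
  have hsq : n ≤ n ^ 2 := Nat.le_self_pow (by omega) n
  have run₁ : Run W (.assign 4 (.add (.reg 0) (.lit 1))) (inputState L) 4
      ((inputState L).setReg 4 (n + 1)) := by
    have := Run.assign (W := W) (s := inputState L) (r := 4) (e := .add (.reg 0) (.lit 1))
      (by simp [Expr.Fits, Expr.eval, inputState]; omega)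
    simpa [Expr.cost, Expr.eval, inputState] using this
  have inv₁ : EdgeInv L L.length ((inputState L).setReg 4 (n + 1)) := by
    refine ⟨?_, ?_, ?_, ?_, ?_, fun x _ => rfl, fun x => ?_, fun x => ?_⟩ <;>
      simp [State.setReg, inputState, edgeSum]
  obtain ⟨t₂, ht₂, m₂, s₂, run₂, inv₂, end₂⟩ := run_loop (W := W) (e := edgeTest) (p := edgeStep)
    (fun m s => EdgeInv L m s)
    (fun m s h => by
      have := h.reg1
      simp only [edgeTest, Expr.Fits, h.reg0]; omega)
    (fun m s h he => by
      have := h.reg1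
      simp only [edgeTest, Expr.eval, h.reg0] at he
      obtain ⟨m, rfl⟩ := Nat.exists_eq_succ_of_ne_zero (show m ≠ 0 by omega)
      obtain ⟨f, hI⟩ := h.step hn hW hlen
      exact ⟨f, m, by omega, hI⟩) _ _ inv₁
  have run₃ : Run W (.assign 1 (.lit 0)) s₂ 2 (s₂.setReg 1 0) :=
    Run.assign (e := .lit 0) (by simp [Expr.Fits])
  have inv₃ : InitInv T k n (s₂.setReg 1 0) := by
    have h1 := inv₂.reg1
    simp only [edgeTest, Expr.eval, inv₂.reg0] at end₂
    have htake : L.take (s₂.reg 1) = L := List.take_of_length_le (by omega)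
    refine ⟨inv₂.reg0, by simp [State.setReg], inv₂.reg2, inv₂.reg3, inv₂.reg4, fun v => ?_,
      fun v => ?_, fun v hv => by simp [State.setReg] at hv⟩
    · refine (inv₂.deg v).trans ?_
      rw [htake, edgeSum_eq hL]; simp
    · refine (inv₂.sum v).trans ?_
      rw [htake, edgeSum_eq hL]
  obtain ⟨t₄, ht₄, m₄, s₄, run₄, inv₄, end₄⟩ := run_loop (W := W) (e := vertexTest)
    (p := initStep k) (fun m s => InitInv T k m s)
    (fun m s h => by
      have := h.reg1
      simp only [vertexTest, Expr.Fits, h.reg0]; omega)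
    (fun m s h he => by
      have := h.reg1
      simp only [vertexTest, Expr.eval, h.reg0] at he
      obtain ⟨m, rfl⟩ := Nat.exists_eq_succ_of_ne_zero (show m ≠ 0 by omega)
      obtain ⟨f, hI⟩ := h.step (W := W) (by omega)
      exact ⟨f, m, by omega, hI⟩) _ _ inv₃
  have run₅ : Run W (.assign 1 (.lit 0)) s₄ 2 (s₄.setReg 1 0) :=
    Run.assign (e := .lit 0) (by simp [Expr.Fits])
  have inv₅ : MainInv T k (2 * n) (s₄.setReg 1 0) Finset.univ id := by
    have h1 := inv₄.reg1
    simp only [vertexTest, Expr.eval, inv₄.reg0] at end₄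
    obtain rfl : m₄ = 0 := by omega
    exact inv₄.main hT hn rfl (fun r hr => by simp [State.setReg, hr]) (by simp [State.setReg])
  obtain ⟨t₆, ht₆, m₆, s₆, run₆, ⟨A, b, inv₆⟩, end₆⟩ := run_loop (W := W) (e := vertexTest)
    (p := mainStep k) (fun m s => ∃ A b, MainInv T k m s A b)
    (fun m s ⟨A, b, h⟩ => by
      have := h.reg12
      simp only [vertexTest, Expr.Fits, h.reg0]; omega)
    (fun m s ⟨A, b, h⟩ he => by
      simp only [vertexTest, Expr.eval, h.reg0] at he
      exact h.step hW (by omega)) _ _ ⟨_, _, inv₅⟩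
  simp only [vertexTest, Expr.eval, inv₆.reg0] at end₆
  obtain ⟨safe₇, r, hr⟩ := inv₆.final (acc := acc) (W := W) (by omega) (by omega)
  obtain ⟨t₇, ht₇, run₇⟩ := safe₇.run
  refine ⟨_, ?_, _, .seq run₁ (.seq run₂ (.seq run₃ (.seq run₄ (.seq run₅ (.seq run₆ run₇))))),
    r, hr⟩
  -- The loops evaluate their tests at most `n`, `n + 1` and `2 * n + 1` times; `n ≥ 1` turns these
  -- into multiples of `n`.
  have b₂ : t₂ ≤ n * (edgeTest.cost + 1 + edgeStep.bound) := by rwa [hlen] at ht₂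
  have b₄ : t₄ ≤ 2 * n * (vertexTest.cost + 1 + (initStep k).bound) :=
    ht₄.trans (Nat.mul_le_mul_right _ (by omega))
  have b₆ : t₆ ≤ 3 * n * (vertexTest.cost + 1 + (mainStep k).bound) :=
    ht₆.trans (Nat.mul_le_mul_right _ (by omega))
  have b₇ : t₇ ≤ n * (finalStep acc).bound := ht₇.trans (Nat.le_mul_of_pos_left _ hn)
  calc _ ≤ n * (edgeTest.cost + 1 + edgeStep.bound) +
        2 * n * (vertexTest.cost + 1 + (initStep k).bound) +
        3 * n * (vertexTest.cost + 1 + (mainStep k).bound) + n * (finalStep acc).bound + n * 8 := by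
        omega
    _ = stepBound acc * n := by rw [stepBound]; ring

/-- The least size of a set with an accepted profile is computable in linear time. -/
theorem computable_of_profile (acc : Profile k → Prop)
    (P : ∀ n : ℕ, SimpleGraph (Fin n) → Finset (Fin n) → Prop)
    (hacc : ∀ n T r S, acc (profile T.dist k Finset.univ r S) ↔ P n T S)
    (huniv : ∀ n (T : SimpleGraph (Fin n)), T.IsTree → P n T Finset.univ)
    {τ : ℕ → ℕ} (hτ : ∀ n, n ≤ τ n) :
    ComputableOnTreesInTime
      (fun n T => ⨅ (S : Finset (Fin n)) (_ : P n T S), (S.card : ℕ∞)) τ := by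
  refine ⟨program acc, stepBound acc + 4, fun n T hT L hL => ?_⟩
  have hn : 1 ≤ n := by have := length_edgeList hT hL; omega
  have hW : 4 * n ^ 2 ≤ (stepBound acc + 4) * n ^ (stepBound acc + 4) :=
    Nat.mul_le_mul (by omega) (Nat.pow_le_pow_right hn (by omega))
  obtain ⟨t, ht, s, hrun, r, hr⟩ := program_spec acc hT hL hW
  refine ⟨t, s, hrun, ht.trans (Nat.mul_le_mul (by omega) (hτ n)), ?_⟩
  have hcard : ∀ S : Finset (Fin n), S.card ≤ n := fun S => by simpa using Finset.card_le_univ S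
  simp only [hacc] at hr
  -- The full vertex set is accepted, so the output is not the overflow value `n + 1`.
  have h0 : s.reg 0 ≤ n := (hr n le_rfl).2 ⟨_, huniv n T hT, hcard _⟩
  apply le_antisymm
  · refine le_iInf₂ fun S hS => ?_
    exact_mod_cast (hr _ (hcard S)).2 ⟨S, hS, le_rfl⟩
  · obtain ⟨S, hS, hle⟩ := (hr _ h0).1 le_rfl
    exact (iInf₂_le S hS).trans (by exact_mod_cast hle)

end TruncProfile

/-! ### Undominated vertices of resolving sets -/

namespace SimpleGraph

variable {V : Type*} {T : SimpleGraph V} {k : ℕ}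

theorem isTruncDomResolving_univ [Fintype V] (hT : T.IsTree) :
    T.IsTruncDomResolving k Finset.univ := by
  refine ⟨fun u v huv => ⟨u, Finset.mem_univ u, ?_⟩, fun v => ⟨v, Finset.mem_univ v, by simp⟩⟩
  have := hT.connected.pos_dist_of_ne huv.symm
  simp only [Distinguishes, truncDist, dist_self]
  omega

theorem IsTruncResolving.eq_of_not_dominated {S : Finset V} (hS : T.IsTruncResolving k S) {u v : V}
    (hu : ¬ T.IsDominatedBy k S u) (hv : ¬ T.IsDominatedBy k S v) : u = v := by
  by_contra huv
  obtain ⟨x, hx, hd⟩ := hS u v huv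
  simp only [IsDominatedBy, not_exists, not_and, not_le] at hu hv
  have h1 := hu x hx
  have h2 := hv x hx
  simp only [Distinguishes, truncDist] at hd
  omega

theorem truncDim_eq_min (T : SimpleGraph V) (k : ℕ) :
    T.truncDim k = min (T.truncDomDim k) (T.truncExceptDim k) := by
  apply le_antisymm
  · refine le_min (le_iInf₂ fun S hS => iInf₂_le S hS.1) ?_
    exact le_iInf fun r => le_iInf₂ fun S hS => iInf₂_le S hS.1
  · refine le_iInf₂ fun S hS => ?_
    by_cases h : ∀ v, T.IsDominatedBy k S v
    · exact (min_le_left _ _).trans (iInf₂_le S ⟨hS, h⟩)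
    · obtain ⟨r, hr⟩ := not_forall.1 h
      refine (min_le_right _ _).trans ((iInf_le _ r).trans (iInf₂_le S ⟨hS, fun v => ?_⟩))
      exact ⟨fun hv => hS.eq_of_not_dominated hv hr, fun hv => hv ▸ hr⟩

end SimpleGraph

theorem mainTheorem2 (k : ℕ) (hk : 1 ≤ k) :
    (∀ (V : Type*) [Finite V] (T : SimpleGraph V), T.IsTree →
      T.truncDim k = min (T.truncDomDim k) (T.truncExceptDim k)) ∧
    WordRAM.ComputableOnTreesInTime (fun _ T => T.truncDomDim k) (fun n => n) ∧
    WordRAM.ComputableOnTreesInTime (fun _ T => T.truncDim k) (fun n => n ^ 2) := by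
  refine ⟨fun V _ T _ => T.truncDim_eq_min k, ?_, ?_⟩
  · exact TruncProfile.computable_of_profile (fun q => TruncProfile.Resolves q ∧
      TruncProfile.Dominates q) (fun _ T S => T.IsTruncDomResolving k S)
      (fun _ T r S => and_congr (TruncProfile.resolves_profile_iff T r S)
        (TruncProfile.dominates_profile_iff T r S))
      (fun _ _ hT => SimpleGraph.isTruncDomResolving_univ hT) fun _ => le_rfl
  -- The same linear-time scheme applies to resolving sets directly; the quadratic bound follows
  -- from `n ≤ n ^ 2`.
  · exact TruncProfile.computable_of_profile TruncProfile.Resolves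
      (fun _ T S => T.IsTruncResolving k S)
      (fun _ T r S => TruncProfile.resolves_profile_iff T r S)
      (fun _ _ hT => (SimpleGraph.isTruncDomResolving_univ hT).1)
      fun n => Nat.le_self_pow (by omega) n
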